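/- Norms of matrices are spectral norms, and $\|a\|_1=\sum_j|a_j|$. **Multiproduct data.** Let $M\ge 1$, $a\in\mathbb{R}^M$ and $\vec k\in\mathbb{Z}_+^M$. For Hermitian matrices $A_1,\dots,A_L$ of the same size write $S_2(t)=e^{-iA_1t/2}\cdots e^{-iA_Lt/2}\,e^{-iA_Lt/2}\cdots e^{-iA_1t/2}$ for the second-order Trotter–Suzuki formula. Assume that $(a,\vec k)$ defines an $M$-term time-independent multiproduct formula of order $2M$: for every finite family of Hermitian matrices $A_1,\dots,A_L$ (of any finite size), $$\Big\|\sum_{j=1}^M a_j\,S_2(t/k_j)^{k_j}-e^{-i(A_1+\dots+A_L)t}\Big\|=O(t^{2M+1})\qquad(t\to0^+).$$ **Hamiltonian.** Let $n_p,q\ge 0$ be integers, and let $H$ be a function with values in the $d\times d$ complex matrices that is Hermitian and infinitely differentiable on $[0,2^q]$ (one-sided derivatives at the end points), with $H(x/2^{n_p})=H((x \bmod 2^{n_p+1})/2^{n_p})$ for all integers $0\le x<2^{n_p+q}$ and $H(1-x)=H(1+x)$ for $x\in[0,1]$. Assume that $$\Lambda=\sup_{t\in[0,2^q],\;p\ge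 0}\|\partial_t^pH(t)\|^{1/(p+1)}$$ is finite. Let $U(t,t_0)$ be the solution of $i\,\partial_tU(t,t_0)=H(t)U(t,t_0)$, $U(t_0,t_0)=1$ on $[0,2^q]$. **Time-dependent multiproduct formula.** Put $U_2(t_0+\delta,t_0)=e^{-iH(t_0+\delta/2)\delta}$ and $$U_{\vec k}(t_0+\delta,t_0)=\sum_{j=1}^Ma_j\prod_{r=1}^{k_j}U_2\big(t_0+\delta r/k_j,\;t_0+\delta (r-1)/k_j\big),$$ with later times on the left in each product. **Theorem.** For all $s\ge 0$ with $s/2^{n_p}\le 2^q$, $$\|U_{\vec k}(s/2^{n_p},0)-U(s/2^{n_p},0)\|\le C\,\|a\|_1\,(\Lambda s/2^{n_p})^{2M+1},$$ where $C>0$ is an absolute constant (independent of $M,a,\vec k,d,H,n_p,q,s$). -/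

import Mathlib

open Set Filter Topology
open scoped Matrix.Norms.L2Operator

namespace MPF

/-- Operators on `ℂ^d`. Throughout, `‖·‖` on this type is the spectral norm (the operator norm
induced by the Euclidean norm), supplied by the scope `Matrix.Norms.L2Operator`. -/
abbrev Op (d : ℕ) : Type := Matrix (Fin d) (Fin d) ℂ

/-! ### Time-independent multiproduct formulas -/

/-- The second-order (symmetric) Trotter–Suzuki formula for `A 0 + ⋯ + A (L-1)`:
`e^{-i t A_0 / 2} ⋯ e^{-i t A_{L-1} / 2} · e^{-i t A_{L-1} / 2} ⋯ e^{-i t A_0 / 2}`. -/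
noncomputable def trotter2 {d L : ℕ} (A : Fin L → Op d) (t : ℝ) : Op d :=
  (List.ofFn fun l => NormedSpace.exp ((-Complex.I * (t / 2 : ℝ)) • A l)).prod *
    (List.ofFn fun l => NormedSpace.exp ((-Complex.I * (t / 2 : ℝ)) • A l)).reverse.prod

/-- The time-independent multiproduct formula `∑ j, a_j S₂(t / k_j) ^ k_j`, where `S₂` is the
second-order Trotter–Suzuki formula. -/
noncomputable def timeIndependentMPF {M d L : ℕ} (a : Fin M → ℝ) (k : Fin M → ℕ)
    (A : Fin L → Op d) (t : ℝ) : Op d :=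
  ∑ j, (a j : ℂ) • trotter2 A (t / k j) ^ k j

/-- `(a, k)` are the data of an `M`-term time-independent multiproduct formula: the `k j` are
positive integers, and for every time-independent Hamiltonian `∑ l, A l`, split into finitely many
Hermitian terms, the error of the multiproduct formula is `O(t ^ (2 M + 1))` as `t → 0⁺`. -/
def IsMPFData {M : ℕ} (a : Fin M → ℝ) (k : Fin M → ℕ) : Prop :=
  (∀ j, 0 < k j) ∧
    ∀ (d L : ℕ) (A : Fin L → Op d), (∀ l, (A l).IsHermitian) →
      (fun t : ℝ => timeIndependentMPF a k A t
          - NormedSpace.exp ((-Complex.I * (t : ℂ)) • ∑ l, A l))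
        =O[𝓝[>] 0] fun t : ℝ => t ^ (2 * M + 1)

/-! ### Time-dependent multiproduct formulas -/

/-- The midpoint formula `U₂(t, t₀) = exp (-i H(t₀ + (t - t₀)/2) (t - t₀))`. -/
noncomputable def midpoint {d : ℕ} (H : ℝ → Op d) (t t₀ : ℝ) : Op d :=
  NormedSpace.exp ((-Complex.I * (t - t₀ : ℝ)) • H (t₀ + (t - t₀) / 2))

/-- The `k`-step midpoint formula on `[t₀, t]`, the product of the factors
`U₂(t₀ + (t - t₀)(r + 1)/k, t₀ + (t - t₀) r/k)`, `r = 0, …, k - 1`, with later times on the left. -/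
noncomputable def midpointSteps {d : ℕ} (H : ℝ → Op d) (k : ℕ) (t t₀ : ℝ) : Op d :=
  ((List.range k).map fun r : ℕ =>
    midpoint H (t₀ + (t - t₀) * ((r + 1 : ℕ) : ℝ) / k) (t₀ + (t - t₀) * (r : ℝ) / k)).reverse.prod

/-- The time-dependent multiproduct formula `U_k(t, t₀) = ∑ j, a_j U₂^{(k_j)}(t, t₀)`. -/
noncomputable def timeDependentMPF {M d : ℕ} (a : Fin M → ℝ) (k : Fin M → ℕ) (H : ℝ → Op d)
    (t t₀ : ℝ) : Op d :=
  ∑ j, (a j : ℂ) • midpointSteps H (k j) t t₀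

/-- `U` is the time evolution operator generated by `H` on the interval `I`:
`i ∂_t U(t, t₀) = H(t) U(t, t₀)` and `U(t₀, t₀) = 1` for all `t, t₀ ∈ I` (with one-sided derivatives
at the end points of `I`). -/
def IsTimeEvolution {d : ℕ} (H : ℝ → Op d) (I : Set ℝ) (U : ℝ → ℝ → Op d) : Prop :=
  ∀ t₀ ∈ I, U t₀ t₀ = 1 ∧
    ∀ t ∈ I, HasDerivWithinAt (fun τ => U τ t₀) (-Complex.I • (H t * U t t₀)) I t

/-- The quantities `‖∂_t^p H(t)‖ ^ (1 / (p + 1))`, for `t ∈ I` and `p = 0, 1, 2, …`. -/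
noncomputable def derivScales {d : ℕ} (H : ℝ → Op d) (I : Set ℝ) : Set ℝ :=
  {x | ∃ t ∈ I, ∃ p : ℕ, x = ‖iteratedDerivWithin p H I t‖ ^ (1 / ((p : ℝ) + 1))}

/-- `Λ = sup_{t ∈ I, p} ‖∂_t^p H(t)‖ ^ (1 / (p + 1))`. It is meaningful when `derivScales H I` is
bounded above. -/
noncomputable def Lam {d : ℕ} (H : ℝ → Op d) (I : Set ℝ) : ℝ := sSup (derivScales H I)

/-- The periodicity and reflection conditions imposed on the grid of `2 ^ (n + q)` clock times of
spacing `2 ^ (-n)`: `H(x / 2^n) = H((x mod 2^(n+1)) / 2^n)` at all grid points, and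
`H(1 - x) = H(1 + x)` for `x ∈ [0, 1]`. -/
def ClockPeriodic {d : ℕ} (H : ℝ → Op d) (n q : ℕ) : Prop :=
  (∀ x : ℕ, x < 2 ^ (n + q) →
    H ((x : ℝ) / 2 ^ n) = H (((x % 2 ^ (n + 1) : ℕ) : ℝ) / 2 ^ n)) ∧
  ∀ x ∈ Icc (0 : ℝ) 1, H (1 - x) = H (1 + x)

/-! ### Existence of the time evolution operator

The time evolution operator exists for every continuous Hamiltonian on a compact interval: it is the
sum of the Dyson series. -/

section Dyson

variable {A : Type*} [NormedRing A] [NormedAlgebra ℝ A]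

/-- The terms of the Dyson series of `∂_t U = G(t) U`, `U(t₀) = 1`. -/
noncomputable def dyson (G : ℝ → A) (t₀ : ℝ) : ℕ → ℝ → A
  | 0 => fun _ => 1
  | n + 1 => fun t => ∫ τ in t₀..t, G τ * dyson G t₀ n τ

theorem continuous_dyson {G : ℝ → A} (hG : Continuous G) (t₀ : ℝ) (n : ℕ) :
    Continuous (dyson G t₀ n) := by
  induction n with
  | zero => exact continuous_const
  | succ n ih =>
    exact intervalIntegral.continuous_primitive
      (fun a b => (hG.mul ih).intervalIntegrable a b) t₀

theorem hasDerivAt_dyson [CompleteSpace A] {G : ℝ → A} (hG : Continuous G) (t₀ : ℝ) (n : ℕ) (t : ℝ) :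
    HasDerivAt (dyson G t₀ (n + 1)) (G t * dyson G t₀ n t) t :=
  (hG.mul (continuous_dyson hG t₀ n)).integral_hasStrictDerivAt t₀ t |>.hasDerivAt

theorem norm_dyson_le {G : ℝ → A} {K : ℝ} (hK : 0 ≤ K) (hGK : ∀ t, ‖G t‖ ≤ K)
    (t₀ : ℝ) (n : ℕ) (t : ℝ) :
    ‖dyson G t₀ n t‖ ≤ ‖(1 : A)‖ * ((K * |t - t₀|) ^ n / n.factorial) := by
  induction n generalizing t with
  | zero => simp [dyson]
  | succ n ih =>
    have h1 : ‖dyson G t₀ (n + 1) t‖ ≤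
        |∫ τ in t₀..t, ‖(1 : A)‖ * (K ^ (n + 1) / n.factorial) * |τ - t₀| ^ n| := by
      refine intervalIntegral.norm_integral_le_abs_of_norm_le (Eventually.of_forall fun τ => ?_) ?_
      · calc ‖G τ * dyson G t₀ n τ‖ ≤ ‖G τ‖ * ‖dyson G t₀ n τ‖ := norm_mul_le _ _
          _ ≤ K * (‖(1 : A)‖ * ((K * |τ - t₀|) ^ n / n.factorial)) :=
              mul_le_mul (hGK τ) (ih τ) (norm_nonneg _) hK
          _ = _ := by rw [mul_pow]; ring
      · exact Continuous.intervalIntegrable (by fun_prop) _ _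
    refine h1.trans (le_of_eq ?_)
    rw [intervalIntegral.integral_const_mul, abs_mul, intervalIntegral.abs_intervalIntegral_eq,
      integral_pow_abs_sub_uIoc, abs_of_nonneg (by positivity),
      abs_of_nonneg (by positivity), Nat.factorial_succ, mul_pow]
    push_cast
    field_simp

theorem hasDerivAt_tsum_dyson [CompleteSpace A] {G : ℝ → A} (hG : Continuous G) {K : ℝ} (hGK : ∀ t, ‖G t‖ ≤ K)
    (t₀ t : ℝ) :
    HasDerivAt (fun τ => ∑' n, dyson G t₀ n τ) (G t * ∑' n, dyson G t₀ n t) t := by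
  have hK : 0 ≤ K := (norm_nonneg _).trans (hGK 0)
  have hsum : ∀ s, Summable fun n => dyson G t₀ n s := fun s =>
    Summable.of_norm_bounded ((Real.summable_pow_div_factorial (K * |s - t₀|)).mul_left ‖(1 : A)‖)
      fun n => norm_dyson_le hK hGK t₀ n s
  set R : ℝ := |t - t₀| + 1 with hR
  have hR0 : 0 ≤ R := by positivity
  have hmem : ∀ s, s ∈ Metric.ball t₀ R ↔ |s - t₀| < R := fun s => by
    rw [Metric.mem_ball, Real.dist_eq]
  have key : HasDerivAt (fun τ => ∑' n, dyson G t₀ (n + 1) τ)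
      (∑' n, G t * dyson G t₀ n t) t := by
    refine hasDerivAt_tsum_of_isPreconnected (𝕜 := ℝ) (F := A)
      (g := fun n => dyson G t₀ (n + 1)) (g' := fun n y => G y * dyson G t₀ n y)
      (u := fun n => K * (‖(1 : A)‖ * ((K * R) ^ n / n.factorial)))
      (((Real.summable_pow_div_factorial (K * R)).mul_left ‖(1 : A)‖).mul_left K)
      (t := Metric.ball t₀ R) Metric.isOpen_ball (convex_ball t₀ R).isPreconnected
      (fun n y _ => hasDerivAt_dyson hG t₀ n y) (fun n y hy => ?_)
      (y₀ := t) ((hmem t).2 (by rw [hR]; linarith)) ((summable_nat_add_iff 1).2 (hsum t))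
      ((hmem t).2 (by rw [hR]; linarith))
    refine (norm_mul_le _ _).trans (mul_le_mul (hGK y) ((norm_dyson_le hK hGK t₀ n y).trans ?_)
      (norm_nonneg _) hK)
    have := ((hmem y).1 hy).le
    gcongr
  rw [(hsum t).tsum_mul_left] at key
  have hfun : (fun τ => ∑' n, dyson G t₀ n τ) = fun τ => 1 + ∑' n, dyson G t₀ (n + 1) τ := by
    funext τ
    exact (hsum τ).tsum_eq_zero_add
  rw [hfun]
  exact key.const_add 1

theorem tsum_dyson_self (G : ℝ → A) (t₀ : ℝ) : ∑' n, dyson G t₀ n t₀ = 1 := by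
  rw [tsum_eq_single 0]
  · rfl
  · intro n hn
    obtain ⟨m, rfl⟩ := Nat.exists_eq_succ_of_ne_zero hn
    simp [dyson]

end Dyson

theorem exists_isTimeEvolution {d : ℕ} (H : ℝ → Op d) {a b : ℝ} (hab : a ≤ b)
    (hH : ContinuousOn H (Icc a b)) : ∃ U, IsTimeEvolution H (Icc a b) U := by
  set G : ℝ → Op d := fun t => -Complex.I • IccExtend hab ((Icc a b).domRestrict H) t with hGdef
  have hE : Continuous (IccExtend hab ((Icc a b).domRestrict H)) :=
    hH.domRestrict.Icc_extend'
  have hG : Continuous G := hE.const_smul (-Complex.I)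
  obtain ⟨K, hK⟩ := (isCompact_Icc (a := a) (b := b)).exists_bound_of_continuousOn hH
  have hGK : ∀ t, ‖G t‖ ≤ K := fun t => by
    have := hK _ (projIcc a b hab t).2
    simpa [hGdef, norm_smul, IccExtend] using this
  refine ⟨fun t t₀ => ∑' n, dyson G t₀ n t, fun t₀ _ => ⟨tsum_dyson_self G t₀, fun t ht => ?_⟩⟩
  have h := (hasDerivAt_tsum_dyson hG hGK t₀ t).hasDerivWithinAt (s := Icc a b)
  have hGt : G t = -Complex.I • H t := by
    simp [hGdef, IccExtend_of_mem hab _ ht]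
  rw [hGt, smul_mul_assoc] at h
  exact h

end MPF

/-!
Adding the derivation `δ = d/dt` turns the time-dependent problem into a time-independent one. For a
formal power series `G`, let `B` be left multiplication by `G` on power series. Then
`e^{cδ} B e^{-cδ}` is multiplication by `t ↦ G(c + t)`, so the midpoint factors telescope into
Strang steps: after evaluation at `0`, `e^{tδ} S(t / k) ^ k` becomes the `k`-step midpoint formula
for `u' = G u`, where `S` splits `-δ + B`, and `e^{tδ} e^{t(-δ + B)}` becomes its exact solution.

The order conditions are only assumed for Hermitian matrices. Multiplied by `-i`, the Hermitian
adjacency matrices of edge-labelled paths separate all words in two letters, so the conditions are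
identities in the free algebra and may be applied to the operators `-δ` and `B`.

With weight `1 / Λ`, the norm of the Taylor series of `-iH` is at most `e Λ`, and hence those of the
multiproduct formula and of the exact evolution are at most `e^e ‖a‖₁` and `e^e`. As the lower
coefficients of their difference vanish, this gives the bound for `Λ t ≤ 1`; for `Λ t > 1` it
follows from unitarity.
-/

namespace MPF

section FormalSeries

open PowerSeries Finset

variable {R : Type*} [Ring R]

theorem X_mul_pow (F : R⟦X⟧) (n : ℕ) : (X * F) ^ n = X ^ n * F ^ n :=
  (commute_X F).symm.mul_pow n

theorem coeff_X_mul_pow_of_lt (F : R⟦X⟧) {m n : ℕ} (h : m < n) : coeff m ((X * F) ^ n) = 0 := by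
  rw [X_mul_pow, coeff_X_pow_mul', if_neg (by omega)]

theorem coeff_mul_congr {P P' Q Q' : R⟦X⟧} {m : ℕ} (h : ∀ i ≤ m, coeff i P = coeff i P')
    (h' : ∀ i ≤ m, coeff i Q = coeff i Q') : coeff m (P * Q) = coeff m (P' * Q') := by
  rw [coeff_mul, coeff_mul]
  refine sum_congr rfl fun ij hij => ?_
  have := mem_antidiagonal.1 hij
  rw [h _ (by omega), h' _ (by omega)]

variable [Algebra ℝ R]

/-- The derivative `∑ (n + 1) c_{n + 1} X ^ n` of a power series over a noncommutative algebra. -/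
noncomputable def formalDeriv : R⟦X⟧ →ₗ[ℝ] R⟦X⟧ where
  toFun P := mk fun n => ((n : ℝ) + 1) • coeff (n + 1) P
  map_add' P Q := by ext n; simp
  map_smul' c P := by ext n; simp [smul_smul, mul_comm]

theorem coeff_formalDeriv (P : R⟦X⟧) (n : ℕ) :
    coeff n (formalDeriv P) = ((n : ℝ) + 1) • coeff (n + 1) P :=
  coeff_mk n fun n => ((n : ℝ) + 1) • coeff (n + 1) P

theorem formalDeriv_mul (P Q : R⟦X⟧) :
    formalDeriv (P * Q) = formalDeriv P * Q + P * formalDeriv Q := by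
  ext n
  have weights : ((n : ℝ) + 1) • coeff (n + 1) (P * Q) =
      ∑ ij ∈ antidiagonal (n + 1), ((ij.1 : ℝ) • coeff ij.1 P) * coeff ij.2 Q +
        ∑ ij ∈ antidiagonal (n + 1), coeff ij.1 P * ((ij.2 : ℝ) • coeff ij.2 Q) := by
    rw [coeff_mul, smul_sum, ← sum_add_distrib]
    refine sum_congr rfl fun ij hij => ?_
    rw [smul_mul_assoc, mul_smul_comm, ← add_smul]
    exact_mod_cast congrArg (fun m : ℕ => (m : ℝ) • (coeff ij.1 P * coeff ij.2 Q))
      (mem_antidiagonal.1 hij).symm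
  rw [coeff_formalDeriv, weights, Nat.sum_antidiagonal_succ, Nat.sum_antidiagonal_succ', map_add,
    coeff_mul, coeff_mul]
  simp [coeff_formalDeriv]

theorem eq_of_formalDeriv_eq_mul {A P Q : R⟦X⟧} (hP : formalDeriv P = A * P)
    (hQ : formalDeriv Q = A * Q) (h₀ : constantCoeff P = constantCoeff Q) : P = Q := by
  ext n
  induction n using Nat.strong_induction_on with
  | _ n ih =>
    cases n with
    | zero => simpa using h₀
    | succ n =>
      have hn : (n : ℝ) + 1 ≠ 0 := n.cast_add_one_ne_zero
      refine (IsUnit.mk0 _ hn).smul_left_cancel.1 ?_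
      rw [← coeff_formalDeriv, ← coeff_formalDeriv, hP, hQ, coeff_mul, coeff_mul]
      refine sum_congr rfl fun ij hij => ?_
      rw [ih _ (by have := mem_antidiagonal.1 hij; omega)]

/-- The power series `exp (t x)` in `t`. -/
noncomputable def expSeries (x : R) : R⟦X⟧ := mk fun n => (n.factorial : ℝ)⁻¹ • x ^ n

theorem coeff_expSeries (x : R) (n : ℕ) :
    coeff n (expSeries x) = (n.factorial : ℝ)⁻¹ • x ^ n := coeff_mk _ _

theorem constantCoeff_expSeries (x : R) : constantCoeff (expSeries x) = 1 := by
  simp [← coeff_zero_eq_constantCoeff_apply, coeff_expSeries, -coeff_zero_eq_constantCoeff]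

theorem expSeries_zero : expSeries (0 : R) = 1 := by
  ext n
  rcases eq_or_ne n 0 with rfl | h <;> simp [coeff_expSeries, coeff_one, *]

theorem formalDeriv_expSeries (x : R) : formalDeriv (expSeries x) = C x * expSeries x := by
  ext n
  rw [coeff_formalDeriv, coeff_C_mul, coeff_expSeries, coeff_expSeries, smul_smul, mul_smul_comm,
    ← pow_succ', Nat.factorial_succ]
  congr 1
  push_cast
  have := n.cast_add_one_ne_zero (R := ℝ)
  have := n.factorial_ne_zero
  field_simp

theorem expSeries_mul_C {x y : R} (h : Commute x y) : expSeries x * C y = C y * expSeries x := by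
  ext n
  rw [coeff_mul_C, coeff_C_mul, coeff_expSeries, smul_mul_assoc, mul_smul_comm, (h.pow_left n).eq]

theorem expSeries_add {x y : R} (h : Commute x y) :
    expSeries (x + y) = expSeries x * expSeries y := by
  refine eq_of_formalDeriv_eq_mul (formalDeriv_expSeries _) ?_
    (by simp [constantCoeff_expSeries])
  rw [formalDeriv_mul, formalDeriv_expSeries, formalDeriv_expSeries, ← mul_assoc (expSeries x),
    expSeries_mul_C h, map_add]
  noncomm_ring

theorem expSeries_add_smul (c c' : ℝ) (x : R) :
    expSeries ((c + c') • x) = expSeries (c • x) * expSeries (c' • x) := by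
  rw [add_smul, expSeries_add (((Commute.refl x).smul_left c).smul_right c')]

theorem expSeries_mul_expSeries_neg (x : R) : expSeries x * expSeries (-x) = 1 := by
  rw [← expSeries_add (Commute.refl x).neg_right, add_neg_cancel, expSeries_zero]

theorem expSeries_neg_mul_expSeries (x : R) : expSeries (-x) * expSeries x = 1 := by
  rw [← expSeries_add (Commute.refl x).neg_left, neg_add_cancel, expSeries_zero]

theorem map_expSeries {S : Type*} [Ring S] [Algebra ℝ S] (f : R →ₐ[ℝ] S) (x : R) :
    PowerSeries.map (f : R →+* S) (expSeries x) = expSeries (f x) := by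
  ext n
  simp [coeff_expSeries]

theorem expSeries_mul_C_eq {x : R} {y : ℕ → R} (h : ∀ p, x * y p - y p * x = y (p + 1)) (c : ℝ) :
    expSeries (c • x) * C (y 0) =
      mk (fun p => (c ^ p * (p.factorial : ℝ)⁻¹) • y p) * expSeries (c • x) := by
  set Y : R⟦X⟧ := mk fun p => (c ^ p * (p.factorial : ℝ)⁻¹) • y p with hY
  have constY : constantCoeff Y = y 0 := by
    rw [← coeff_zero_eq_constantCoeff_apply, hY, coeff_mk]
    simp
  have deriv_Y : formalDeriv Y = C (c • x) * Y - Y * C (c • x) := by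
    ext p
    rw [coeff_formalDeriv, map_sub, coeff_C_mul, coeff_mul_C, hY, coeff_mk, coeff_mk, smul_smul,
      smul_mul_smul_comm, smul_mul_smul_comm, mul_comm _ c, ← smul_sub, h, Nat.factorial_succ]
    congr 1
    push_cast
    have := p.cast_add_one_ne_zero (R := ℝ)
    field_simp
    ring
  refine eq_of_formalDeriv_eq_mul (A := C (c • x)) ?_ ?_
    (by simp [constY, constantCoeff_expSeries])
  · have : formalDeriv (C (y 0)) = 0 := by ext n; simp [coeff_formalDeriv]
    rw [formalDeriv_mul, formalDeriv_expSeries, this, mul_zero, add_zero, mul_assoc]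
  · rw [formalDeriv_mul, formalDeriv_expSeries, deriv_Y]
    noncomm_ring

/-- The power series `exp (t F(t))` in `t`. The powers `(X * F) ^ n` with `n > m` do not contribute
to the coefficient of order `m`. -/
noncomputable def expXMul (F : R⟦X⟧) : R⟦X⟧ :=
  mk fun m => ∑ n ∈ range (m + 1), (n.factorial : ℝ)⁻¹ • coeff m ((X * F) ^ n)

theorem coeff_expXMul (F : R⟦X⟧) {m N : ℕ} (h : m < N) :
    coeff m (expXMul F) = coeff m (∑ n ∈ range N, (n.factorial : ℝ)⁻¹ • (X * F) ^ n) := by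
  rw [expXMul, coeff_mk, map_sum]
  refine sum_subset (range_mono h) (fun n _ hn => ?_) |>.trans (sum_congr rfl fun n _ => by simp)
  rw [coeff_X_mul_pow_of_lt F (by simpa using hn), smul_zero]

theorem expXMul_conj {u v : R⟦X⟧} (hvu : v * u = 1) (huv : u * v = 1) (F : R⟦X⟧) :
    expXMul (u * F * v) = u * expXMul F * v := by
  have conj_pow (n : ℕ) : (X * (u * F * v)) ^ n = u * (X * F) ^ n * v := by
    have hX : X * (u * F * v) = u * (X * F) * v := by
      rw [← mul_assoc, ← mul_assoc, ← mul_assoc, (commute_X u).eq]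
    exact hX ▸ Units.conj_pow ⟨u, v, huv, hvu⟩ (X * F) n
  ext m
  have truncate : coeff m (u * expXMul F * v) =
      coeff m (u * (∑ n ∈ range (m + 1), (n.factorial : ℝ)⁻¹ • (X * F) ^ n) * v) :=
    coeff_mul_congr (fun i hi => coeff_mul_congr (fun _ _ => rfl)
      fun j hj => coeff_expXMul F (by omega)) (fun _ _ => rfl)
  rw [truncate, coeff_expXMul _ m.lt_succ_self, mul_sum, sum_mul]
  simp only [conj_pow, mul_smul_comm, smul_mul_assoc]

theorem expXMul_C (x : R) : expXMul (C x) = expSeries x := by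
  ext m
  rw [expXMul, coeff_mk, coeff_expSeries, sum_eq_single m]
  · simp [X_mul_pow, ← map_pow]
  · intro n _ hn
    rw [X_mul_pow, ← map_pow, coeff_X_pow_mul', coeff_C, ite_eq_right_iff.2 fun h =>
      if_neg (by omega), smul_zero]
  · simp

/-- The coefficients of the formal solution of `u' = G u`, `u(0) = 1`. -/
noncomputable def evolutionCoeff (G : R⟦X⟧) : ℕ → R
  | 0 => 1
  | n + 1 => ((n : ℝ) + 1)⁻¹ • ∑ i : Fin (n + 1), coeff (n - i) G * evolutionCoeff G i

/-- The formal solution of `u' = G u`, `u(0) = 1`. -/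
noncomputable def evolutionSeries (G : R⟦X⟧) : R⟦X⟧ := mk (evolutionCoeff G)

theorem constantCoeff_evolutionSeries (G : R⟦X⟧) : constantCoeff (evolutionSeries G) = 1 := by
  rw [← coeff_zero_eq_constantCoeff_apply, evolutionSeries, coeff_mk, evolutionCoeff]

theorem formalDeriv_evolutionSeries (G : R⟦X⟧) :
    formalDeriv (evolutionSeries G) = G * evolutionSeries G := by
  ext n
  rw [coeff_formalDeriv, evolutionSeries, coeff_mk, evolutionCoeff, smul_smul,
    mul_inv_cancel₀ n.cast_add_one_ne_zero, one_smul, coeff_mul, ← Nat.sum_antidiagonal_swap,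
    Nat.sum_antidiagonal_eq_sum_range_succ_mk, Finset.sum_range]
  simp

/-- The power series `G(c t)` in `t`. -/
noncomputable def dilate (c : ℝ) (G : R⟦X⟧) : R⟦X⟧ := mk fun p => c ^ p • coeff p G

theorem coeff_dilate (c : ℝ) (G : R⟦X⟧) (p : ℕ) : coeff p (dilate c G) = c ^ p • coeff p G :=
  coeff_mk _ _

end FormalSeries

section OrderConditions

open PowerSeries Finset

variable {R : Type*} [Ring R] [Algebra ℝ R]

/-- The power series in `t` of a Strang splitting step `e^{t h x / 2} e^{t h y} e^{t h x / 2}`. -/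
noncomputable def strangSeries (h : ℝ) (x y : R) : R⟦X⟧ :=
  expSeries ((h / 2) • x) * expSeries (h • y) * expSeries ((h / 2) • x)

theorem constantCoeff_strangSeries (h : ℝ) (x y : R) : constantCoeff (strangSeries h x y) = 1 := by
  simp [strangSeries, constantCoeff_expSeries]

variable {J : Type*} [Fintype J] {a : J → ℝ} {k : J → ℕ} {N : ℕ}

/-- The power series in `t` of the error `∑ j, a_j S(t / k_j) ^ k_j - e^{t (x + y)}` of the
multiproduct formula built from the Strang splitting `S(t) = e^{t x / 2} e^{t y} e^{t x / 2}`. -/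
noncomputable def errorSeries (a : J → ℝ) (k : J → ℕ) (x y : R) : R⟦X⟧ :=
  ∑ j, a j • strangSeries (k j : ℝ)⁻¹ x y ^ k j - expSeries (x + y)

/-- The multiproduct formula with weights `a` and step numbers `k` has order at least `N` as a
formal identity: its error for two free noncommuting generators vanishes below order `N`. -/
def OrderConditions (a : J → ℝ) (k : J → ℕ) (N : ℕ) : Prop :=
  ∀ n < N, coeff n (errorSeries a k (FreeAlgebra.ι ℝ (0 : Fin 2)) (FreeAlgebra.ι ℝ 1)) = 0

theorem coeff_real_smul (c : ℝ) (P : R⟦X⟧) (n : ℕ) : coeff n (c • P) = c • coeff n P := rfl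

theorem map_errorSeries {S : Type*} [Ring S] [Algebra ℝ S] (f : R →ₐ[ℝ] S) (a : J → ℝ) (k : J → ℕ)
    (x y : R) :
    PowerSeries.map (f : R →+* S) (errorSeries a k x y) = errorSeries a k (f x) (f y) := by
  have map_smul' (c : ℝ) (P : R⟦X⟧) :
      PowerSeries.map (f : R →+* S) (c • P) = c • PowerSeries.map (f : R →+* S) P := by
    ext n
    simp
  simp only [errorSeries, strangSeries, map_sub, map_sum, map_smul', map_pow, map_mul,
    map_expSeries, map_smul, map_add]

theorem lift_coeff_errorSeries (a : J → ℝ) (k : J → ℕ) (z : Fin 2 → R) (n : ℕ) :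
    FreeAlgebra.lift ℝ z (coeff n (errorSeries a k (FreeAlgebra.ι ℝ 0) (FreeAlgebra.ι ℝ 1))) =
      coeff n (errorSeries a k (z 0) (z 1)) := by
  simpa using congrArg (coeff n)
    (map_errorSeries (FreeAlgebra.lift ℝ z) a k (FreeAlgebra.ι ℝ 0) (FreeAlgebra.ι ℝ 1))

theorem OrderConditions.coeff_errorSeries (h : OrderConditions a k N) (x y : R) {n : ℕ}
    (hn : n < N) : coeff n (errorSeries a k x y) = 0 := by
  simpa [h n hn] using (lift_coeff_errorSeries a k ![x, y] n).symm

theorem OrderConditions.sum_eq_one (h : OrderConditions a k N) (hN : 0 < N) : ∑ j, a j = 1 := by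
  have := h.coeff_errorSeries (0 : ℝ) 0 hN
  simpa [errorSeries, coeff_real_smul, constantCoeff_strangSeries, constantCoeff_expSeries,
    sub_eq_zero] using this

theorem OrderConditions.one_le_sum_abs (h : OrderConditions a k N) (hN : 0 < N) :
    1 ≤ ∑ j, |a j| := by
  simpa [h.sum_eq_one hN] using abs_sum_le_sum_abs a univ

theorem coeff_errorSeries_mem (a : J → ℝ) (k : J → ℕ) (x y : R) (n : ℕ) :
    coeff n (errorSeries a k x y) ∈ Submodule.span ℝ {x, y} ^ n := by
  set V := Submodule.span ℝ ({x, y} : Set R)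
  have hx : x ∈ V := Submodule.subset_span (by simp)
  have hy : y ∈ V := Submodule.subset_span (by simp)
  have exp_mem {z : R} (hz : z ∈ V) (n : ℕ) : coeff n (expSeries z) ∈ V ^ n := by
    rw [coeff_expSeries]
    exact Submodule.smul_mem _ _ (Submodule.pow_mem_pow V hz n)
  have mul_mem {P Q : R⟦X⟧} (hP : ∀ n, coeff n P ∈ V ^ n) (hQ : ∀ n, coeff n Q ∈ V ^ n) (n : ℕ) :
      coeff n (P * Q) ∈ V ^ n := by
    rw [coeff_mul]
    refine Submodule.sum_mem _ fun ij hij => ?_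
    rw [← mem_antidiagonal.1 hij, pow_add]
    exact Submodule.mul_mem_mul (hP _) (hQ _)
  have pow_mem {P : R⟦X⟧} (hP : ∀ n, coeff n P ∈ V ^ n) (r : ℕ) : ∀ n, coeff n (P ^ r) ∈ V ^ n := by
    induction r with
    | zero => rw [pow_zero, ← expSeries_zero]; exact exp_mem V.zero_mem
    | succ r ih => rw [pow_succ]; exact mul_mem ih hP
  have strang_mem (h : ℝ) : ∀ n, coeff n (strangSeries h x y) ∈ V ^ n :=
    mul_mem (mul_mem (exp_mem (V.smul_mem _ hx)) (exp_mem (V.smul_mem _ hy)))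
      (exp_mem (V.smul_mem _ hx))
  rw [errorSeries, map_sub, map_sum]
  exact Submodule.sub_mem _ (Submodule.sum_mem _ fun j _ =>
    Submodule.smul_mem _ _ (pow_mem (strang_mem _) _ n)) (exp_mem (V.add_mem hx hy) n)

end OrderConditions

section Transfer

open PowerSeries Finset

theorem prod_conj_expSeries {R : Type*} [Ring R] [Algebra ℝ R] (δ B : R) (h : ℝ) (m : ℕ) :
    ((List.range m).map fun r : ℕ => expSeries (((r + 1 / 2) * h) • δ) * expSeries (h • B) *
      expSeries (-(((r + 1 / 2) * h) • δ))).reverse.prod =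
    expSeries ((m * h) • δ) * strangSeries h (-δ) B ^ m := by
  induction m with
  | zero => simp [expSeries_zero]
  | succ m ih =>
    have left_factor : expSeries (((m + 1 / 2) * h) • δ) =
        expSeries (((m + 1 : ℕ) * h) • δ) * expSeries ((h / 2) • -δ) := by
      rw [smul_neg, ← neg_smul, ← expSeries_add_smul]
      congr 2
      push_cast
      ring
    have right_factor : expSeries (-(((m + 1 / 2) * h) • δ)) * expSeries ((m * h) • δ) =
        expSeries ((h / 2) • -δ) := by
      rw [← neg_smul, ← expSeries_add_smul, smul_neg, ← neg_smul]
      congr 2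
      ring
    rw [List.range_succ, List.map_append, List.reverse_append, List.prod_append, ih,
      List.map_singleton, List.reverse_singleton, List.prod_singleton, mul_assoc,
      ← mul_assoc (expSeries (-_)), right_factor, left_factor, pow_succ', strangSeries]
    noncomm_ring

variable {A : Type*} [Ring A] [Algebra ℝ A]

/-- The power series in `t` of the `m`-step midpoint formula with steps of length `h t` for
`u' = G u`, later times on the left. -/
noncomputable def midpointSeries (G : A⟦X⟧) (h : ℝ) (m : ℕ) : A⟦X⟧ :=
  ((List.range m).map fun r : ℕ => expXMul (h • dilate ((r + 1 / 2) * h) G)).reverse.prod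

/-- The power series `∑ p, (c t) ^ p / p! • L (G⁽ᵖ⁾)` in `t`, where `L F` is left multiplication by
`F`. -/
noncomputable def mulLeftTaylor (c : ℝ) (G : A⟦X⟧) : (Module.End ℝ A⟦X⟧)⟦X⟧ :=
  mk fun p => (c ^ p * (p.factorial : ℝ)⁻¹) • LinearMap.mulLeft ℝ (formalDeriv^[p] G)

theorem constantCoeff_iterate_formalDeriv (G : A⟦X⟧) (p : ℕ) :
    constantCoeff (formalDeriv^[p] G) = (p.factorial : ℝ) • coeff p G := by
  induction p generalizing G with
  | zero => simp
  | succ p ih =>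
    rw [Function.iterate_succ_apply, ih, coeff_formalDeriv, smul_smul, Nat.factorial_succ]
    push_cast
    rw [mul_comm]

theorem formalDeriv_mul_mulLeft_sub (G : A⟦X⟧) :
    formalDeriv * LinearMap.mulLeft ℝ G - LinearMap.mulLeft ℝ G * formalDeriv =
      LinearMap.mulLeft ℝ (formalDeriv G) := by
  refine LinearMap.ext fun f => ?_
  simp [formalDeriv_mul]

theorem expSeries_mul_C_mulLeft (G : A⟦X⟧) (c : ℝ) :
    expSeries (c • formalDeriv (R := A)) * C (LinearMap.mulLeft ℝ G) =
      mulLeftTaylor c G * expSeries (c • formalDeriv (R := A)) :=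
  expSeries_mul_C_eq (y := fun p => LinearMap.mulLeft ℝ (formalDeriv^[p] G))
    (fun p => by rw [formalDeriv_mul_mulLeft_sub, Function.iterate_succ_apply']) c

/-- Evaluation at `0` carries the operator-valued series `P`, which acts on jets of functions with
values in `A`, to left multiplication by the series `Q`. -/
def Intertwines (P : (Module.End ℝ A⟦X⟧)⟦X⟧) (Q : A⟦X⟧) : Prop :=
  ∀ n f, constantCoeff (coeff n P f) = coeff n Q * constantCoeff f

namespace Intertwines

variable {P P' : (Module.End ℝ A⟦X⟧)⟦X⟧} {Q Q' : A⟦X⟧}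

theorem mul (h : Intertwines P Q) (h' : Intertwines P' Q') :
    Intertwines (P * P') (Q * Q') := by
  intro n f
  rw [coeff_mul, coeff_mul, LinearMap.sum_apply, map_sum, sum_mul]
  refine sum_congr rfl fun ij _ => ?_
  rw [Module.End.mul_apply, h, h', mul_assoc]

theorem one : Intertwines (1 : (Module.End ℝ A⟦X⟧)⟦X⟧) 1 := by
  intro n f
  rw [coeff_one, coeff_one]
  split_ifs <;> simp

theorem X : Intertwines (X : (Module.End ℝ A⟦X⟧)⟦X⟧) X := by
  intro n f
  rw [coeff_X, coeff_X]
  split_ifs <;> simp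

theorem smul (h : Intertwines P Q) (c : ℝ) : Intertwines (c • P) (c • Q) := by
  intro n f
  rw [coeff_real_smul, coeff_real_smul, LinearMap.smul_apply, smul_mul_assoc, ← h n f]
  rfl

theorem sum {ι : Type*} {s : Finset ι} {P : ι → (Module.End ℝ A⟦X⟧)⟦X⟧} {Q : ι → A⟦X⟧}
    (h : ∀ i ∈ s, Intertwines (P i) (Q i)) : Intertwines (∑ i ∈ s, P i) (∑ i ∈ s, Q i) := by
  intro n f
  rw [map_sum, map_sum, LinearMap.sum_apply, map_sum, sum_mul]
  exact sum_congr rfl fun i hi => h i hi n f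

theorem pow (h : Intertwines P Q) (r : ℕ) : Intertwines (P ^ r) (Q ^ r) := by
  induction r with
  | zero => simpa using Intertwines.one
  | succ r ih => rw [pow_succ, pow_succ]; exact ih.mul h

theorem list_prod_reverse {P : ℕ → (Module.End ℝ A⟦X⟧)⟦X⟧} {Q : ℕ → A⟦X⟧}
    (h : ∀ r, Intertwines (P r) (Q r)) (m : ℕ) :
    Intertwines ((List.range m).map P).reverse.prod ((List.range m).map Q).reverse.prod := by
  induction m with
  | zero => simpa using Intertwines.one
  | succ m ih => simpa [List.range_succ] using (h m).mul ih

theorem expXMul (h : Intertwines P Q) : Intertwines (expXMul P) (expXMul Q) := by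
  intro n f
  rw [coeff_expXMul P n.lt_succ_self, coeff_expXMul Q n.lt_succ_self]
  exact Intertwines.sum (fun i _ => ((Intertwines.X.mul h).pow i).smul _) n f

theorem evolutionSeries {T : (Module.End ℝ A⟦X⟧)⟦X⟧} {G : A⟦X⟧} (hT : Intertwines T G)
    (hP : formalDeriv P = T * P) (h₀ : constantCoeff P = 1) :
    Intertwines P (evolutionSeries G) := by
  intro n
  induction n using Nat.strong_induction_on with
  | _ n ih =>
    intro f
    cases n with
    | zero => simp [h₀, constantCoeff_evolutionSeries]
    | succ n =>
      have hn : (n : ℝ) + 1 ≠ 0 := n.cast_add_one_ne_zero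
      refine (IsUnit.mk0 _ hn).smul_left_cancel.1 ?_
      rw [← smul_mul_assoc, ← coeff_formalDeriv, formalDeriv_evolutionSeries,
        ← coeff_zero_eq_constantCoeff_apply, ← coeff_real_smul, ← LinearMap.smul_apply,
        ← coeff_formalDeriv, hP, coeff_zero_eq_constantCoeff_apply, coeff_mul, coeff_mul,
        LinearMap.sum_apply, map_sum, sum_mul]
      refine sum_congr rfl fun ij hij => ?_
      rw [Module.End.mul_apply, hT, ih _ (by have := mem_antidiagonal.1 hij; omega), mul_assoc]

end Intertwines

theorem intertwines_mulLeftTaylor (c : ℝ) (G : A⟦X⟧) :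
    Intertwines (mulLeftTaylor c G) (dilate c G) := by
  intro p f
  have hp : (p.factorial : ℝ) ≠ 0 := Nat.cast_ne_zero.2 p.factorial_ne_zero
  rw [mulLeftTaylor, coeff_mk, coeff_dilate, LinearMap.smul_apply, smul_mul_assoc,
    ← coeff_zero_eq_constantCoeff_apply, coeff_real_smul, coeff_zero_eq_constantCoeff_apply,
    LinearMap.mulLeft_apply, map_mul, constantCoeff_iterate_formalDeriv, smul_mul_assoc, smul_smul,
    mul_assoc, inv_mul_cancel₀ hp, mul_one]

theorem intertwines_midpointSeries (G : A⟦X⟧) (h : ℝ) (m : ℕ) :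
    Intertwines (expSeries ((m * h) • formalDeriv (R := A)) *
      strangSeries h (-formalDeriv (R := A)) (LinearMap.mulLeft ℝ G) ^ m)
      (midpointSeries G h m) := by
  rw [← prod_conj_expSeries]
  refine Intertwines.list_prod_reverse (fun r => ?_) m
  set c : ℝ := (r + 1 / 2) * h
  have conj_C : h • mulLeftTaylor c G = expSeries (c • formalDeriv (R := A)) *
      C (h • LinearMap.mulLeft ℝ G) * expSeries (-(c • formalDeriv (R := A))) := by
    have : C (h • LinearMap.mulLeft ℝ G) = h • C (LinearMap.mulLeft ℝ G) := by
      ext n : 1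
      rw [coeff_real_smul, coeff_C, coeff_C]
      split_ifs <;> simp
    rw [this, mul_smul_comm, smul_mul_assoc, expSeries_mul_C_mulLeft, mul_assoc,
      expSeries_mul_expSeries_neg, mul_one]
  rw [← expXMul_C (h • _), ← expXMul_conj (expSeries_neg_mul_expSeries _)
    (expSeries_mul_expSeries_neg _), ← conj_C]
  exact ((intertwines_mulLeftTaylor c G).smul h).expXMul

theorem intertwines_evolutionSeries (G : A⟦X⟧) :
    Intertwines (expSeries (formalDeriv (R := A)) *
      expSeries (-formalDeriv (R := A) + LinearMap.mulLeft ℝ G)) (evolutionSeries G) := by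
  set B := LinearMap.mulLeft ℝ G
  have hT : Intertwines (mulLeftTaylor 1 G) G := by
    have : dilate 1 G = G := by ext n; simp [coeff_dilate]
    simpa only [this] using intertwines_mulLeftTaylor 1 G
  refine hT.evolutionSeries ?_ (by simp [constantCoeff_expSeries])
  have conj_B := expSeries_mul_C_mulLeft G 1
  rw [one_smul] at conj_B
  rw [formalDeriv_mul, formalDeriv_expSeries, formalDeriv_expSeries, ← mul_assoc, ← mul_assoc,
    ← conj_B, ← expSeries_mul_C (Commute.refl (formalDeriv (R := A))), ← add_mul, ← mul_add,
    ← map_add, add_neg_cancel_left]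

variable {J : Type*} [Fintype J] {a : J → ℝ} {k : J → ℕ} {N : ℕ}

theorem OrderConditions.coeff_sum_midpointSeries (hN : OrderConditions a k N) (hk : ∀ j, 0 < k j)
    (G : A⟦X⟧) {n : ℕ} (hn : n < N) :
    coeff n (∑ j, a j • midpointSeries G (k j : ℝ)⁻¹ (k j)) = coeff n (evolutionSeries G) := by
  set δ : Module.End ℝ A⟦X⟧ := formalDeriv
  set B : Module.End ℝ A⟦X⟧ := LinearMap.mulLeft ℝ G
  have mpf : Intertwines (∑ j, a j • (expSeries δ * strangSeries (k j : ℝ)⁻¹ (-δ) B ^ k j))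
      (∑ j, a j • midpointSeries G (k j : ℝ)⁻¹ (k j)) := by
    refine Intertwines.sum fun j _ => Intertwines.smul ?_ _
    have hj : (k j : ℝ) * (k j : ℝ)⁻¹ = 1 := mul_inv_cancel₀ (by exact_mod_cast (hk j).ne')
    simpa only [hj, one_smul] using intertwines_midpointSeries G (k j : ℝ)⁻¹ (k j)
  have split : ∑ j, a j • (expSeries δ * strangSeries (k j : ℝ)⁻¹ (-δ) B ^ k j) =
      expSeries δ * errorSeries a k (-δ) B + expSeries δ * expSeries (-δ + B) := by
    rw [errorSeries, ← mul_add, sub_add_cancel, mul_sum]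
    simp only [mul_smul_comm]
  have error_eq_zero : coeff n (expSeries δ * errorSeries a k (-δ) B) = 0 := by
    rw [coeff_mul_congr (fun _ _ => rfl) (Q' := 0)
      (fun i hi => by rw [hN.coeff_errorSeries _ _ (hi.trans_lt hn), map_zero]), mul_zero, map_zero]
  have := mpf n 1
  rw [split, map_add, error_eq_zero, zero_add, intertwines_evolutionSeries G n, map_one, mul_one,
    mul_one] at this
  exact this.symm

end Transfer

section Words

open Finset

variable {ι : Type*} [DecidableEq ι] {n : ℕ}

/-- The adjacency matrix of the edges labelled `l` of the path `0, …, n` whose edge `{p, p + 1}` is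
labelled by `w p`. A product of `n` such matrices leads from `0` to `n` only if their labels spell
the word `w`. -/
def pathMatrix (w : Fin n → ι) (l : ι) : Op (n + 1) := fun i j =>
  if ∃ p, w p = l ∧ (i = p.castSucc ∧ j = p.succ ∨ i = p.succ ∧ j = p.castSucc) then 1 else 0

theorem isHermitian_pathMatrix (w : Fin n → ι) (l : ι) : (pathMatrix w l).IsHermitian := by
  ext i j
  simp only [pathMatrix, Matrix.conjTranspose_apply, apply_ite star, star_one, star_zero]
  simp only [or_comm, and_comm]

theorem pathMatrix_castSucc_succ (w : Fin n → ι) (l : ι) (p : Fin n) :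
    pathMatrix w l p.castSucc p.succ = if l = w p then 1 else 0 := by
  refine if_congr ⟨?_, fun h => ⟨p, h.symm, Or.inl ⟨rfl, rfl⟩⟩⟩ rfl rfl
  rintro ⟨q, rfl, h⟩
  simp only [Fin.ext_iff, Fin.val_castSucc, Fin.val_succ] at h
  congr 1
  exact Fin.ext (by omega)

theorem pathMatrix_eq_zero {w : Fin n → ι} {i j : Fin (n + 1)} (h : (j : ℕ) ≠ i + 1)
    (h' : (i : ℕ) ≠ j + 1) (l : ι) : pathMatrix w l i j = 0 := by
  refine if_neg ?_
  rintro ⟨p, -, ⟨rfl, rfl⟩ | ⟨rfl, rfl⟩⟩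
  · exact h rfl
  · exact h' rfl

theorem pathMatrix_prod_apply_last (w : Fin n → ι) (v : List ι) (i : Fin (n + 1))
    (hi : i + v.length ≤ n) :
    (v.map (pathMatrix w)).prod i (Fin.last n) =
      if v = (List.ofFn w).drop i then 1 else 0 := by
  induction v generalizing i with
  | nil =>
    rw [List.map_nil, List.prod_nil, Matrix.one_apply]
    refine if_congr ?_ rfl rfl
    rw [eq_comm (a := []), List.drop_eq_nil_iff, List.length_ofFn, Fin.ext_iff, Fin.val_last]
    omega
  | cons a v ih =>
    rw [List.length_cons] at hi
    obtain ⟨p, rfl⟩ := Fin.exists_castSucc_eq.2 (fun h => by simp [h] at hi : i ≠ Fin.last n)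
    rw [Fin.val_castSucc] at hi
    have other_zero (l : Fin (n + 1)) (hl : l ≠ p.succ) :
        pathMatrix w a p.castSucc l * (v.map (pathMatrix w)).prod l (Fin.last n) = 0 := by
      by_cases hp : (p : ℕ) = l + 1
      · have too_short : v ≠ (List.ofFn w).drop l := fun h => by
          have := congrArg List.length h
          rw [List.length_drop, List.length_ofFn] at this
          omega
        rw [ih l (by omega), if_neg too_short, mul_zero]
      · rw [pathMatrix_eq_zero (fun h => hl (Fin.ext h)) hp, zero_mul]
    have drop_eq : (List.ofFn w).drop p = w p :: (List.ofFn w).drop p.succ := by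
      rw [List.drop_eq_getElem_cons (by simp)]
      simp
    rw [List.map_cons, List.prod_cons, Matrix.mul_apply,
      sum_eq_single p.succ (fun l _ hl => other_zero l hl) (by simp), pathMatrix_castSucc_succ,
      ih p.succ (by rw [Fin.val_succ]; omega), Fin.val_castSucc, drop_eq, ite_mul, one_mul,
      zero_mul, ← ite_and]
    simp only [List.cons.injEq]

theorem lift_smul_pathMatrix_word (w v : Fin n → ι) (c : ℂ) :
    FreeAlgebra.lift ℝ (fun l => c • pathMatrix w l)
      (List.ofFn fun p => FreeAlgebra.ι ℝ (v p)).prod 0 (Fin.last n) =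
      if v = w then c ^ n else 0 := by
  have entry := pathMatrix_prod_apply_last w (List.ofFn v) 0 (by simp)
  have map_word : ((List.ofFn fun p => FreeAlgebra.ι ℝ (v p)).map
      (FreeAlgebra.lift ℝ fun l => c • pathMatrix w l)).prod =
        c ^ n • ((List.ofFn v).map (pathMatrix w)).prod := by
    simpa [List.map_ofFn, Function.comp_def] using
      (List.smul_prod (l := (List.ofFn v).map (pathMatrix w)) (m := c)).symm
  rw [map_list_prod, map_word, Matrix.smul_apply, entry]
  simp [List.ofFn_inj]

theorem eq_zero_of_lift_smul_pathMatrix [Finite ι] {x : FreeAlgebra ℝ ι}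
    (hx : x ∈ Submodule.span ℝ (Set.range (FreeAlgebra.ι ℝ : ι → FreeAlgebra ℝ ι)) ^ n) {c : ℂ}
    (hc : c ≠ 0)
    (h : ∀ w : Fin n → ι, FreeAlgebra.lift ℝ (fun l => c • pathMatrix w l) x = 0) : x = 0 := by
  cases nonempty_fintype ι
  have words : x ∈ Submodule.span ℝ
      (Set.range fun v : Fin n → ι => (List.ofFn fun p => FreeAlgebra.ι ℝ (v p)).prod) := by
    rw [Submodule.span_pow] at hx
    refine Submodule.span_mono ?_ hx
    rintro _ hz
    obtain ⟨f, rfl⟩ := Set.mem_pow.1 hz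
    choose v hv using fun p => (f p).2
    exact ⟨v, by simp only [hv]⟩
  obtain ⟨γ, rfl⟩ := (Submodule.mem_span_range_iff_exists_fun ℝ).1 words
  refine sum_eq_zero fun w _ => ?_
  have entry := congrFun (congrFun (h w) 0) (Fin.last n)
  simp only [map_sum, map_smul, Matrix.sum_apply, Matrix.smul_apply, lift_smul_pathMatrix_word,
    smul_ite, smul_zero, sum_ite_eq', Finset.mem_univ, if_true, Matrix.zero_apply] at entry
  rw [(smul_eq_zero.1 entry).resolve_right (pow_ne_zero n hc), zero_smul]

end Words

section WeightedNorm

open PowerSeries Finset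

variable {A : Type*} [NormedRing A] {P Q : A⟦X⟧} {x y K L : ℝ}

theorem sum_sum_antidiagonal_mul_le {f g : ℕ → ℝ} (hf : ∀ n, 0 ≤ f n) (hg : ∀ n, 0 ≤ g n) (N : ℕ) :
    ∑ n ∈ range N, ∑ ij ∈ antidiagonal n, f ij.1 * g ij.2 ≤
      (∑ n ∈ range N, f n) * ∑ n ∈ range N, g n := by
  rw [sum_mul_sum, ← sum_product', sum_sigma']
  have injOn : Set.InjOn (Sigma.snd : (Σ _ : ℕ, ℕ × ℕ) → ℕ × ℕ)
      ((range N).sigma fun n => antidiagonal n : Finset _) := by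
    rintro ⟨n, ij⟩ hn ⟨m, ij'⟩ hm rfl
    simp only [coe_sigma, Set.mem_sigma_iff, mem_coe, HasAntidiagonal.mem_antidiagonal] at hn hm
    rw [← hn.2, ← hm.2]
  refine (sum_image (f := fun ij : ℕ × ℕ => f ij.1 * g ij.2) injOn).symm.trans_le
    (sum_le_sum_of_subset_of_nonneg ?_ fun ij _ _ => mul_nonneg (hf _) (hg _))
  intro ij hij
  obtain ⟨⟨n, _⟩, h, rfl⟩ := Finset.mem_image.1 hij
  simp only [Finset.mem_sigma, HasAntidiagonal.mem_antidiagonal, Finset.mem_range,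
    mem_product] at h ⊢
  omega

theorem sum_norm_coeff_mul_le (P Q : A⟦X⟧) (hx : 0 ≤ x) (N : ℕ) :
    ∑ n ∈ range N, ‖coeff n (P * Q)‖ * x ^ n ≤
      (∑ n ∈ range N, ‖coeff n P‖ * x ^ n) * ∑ n ∈ range N, ‖coeff n Q‖ * x ^ n := by
  refine (sum_le_sum fun n _ => ?_).trans (sum_sum_antidiagonal_mul_le
    (fun n => by positivity) (fun n => by positivity) N)
  rw [coeff_mul]
  calc ‖∑ ij ∈ antidiagonal n, coeff ij.1 P * coeff ij.2 Q‖ * x ^ n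
      ≤ (∑ ij ∈ antidiagonal n, ‖coeff ij.1 P‖ * ‖coeff ij.2 Q‖) * x ^ n := by
        gcongr
        exact norm_sum_le_of_le _ fun _ _ => norm_mul_le _ _
    _ = _ := by
        rw [sum_mul]
        refine sum_congr rfl fun ij hij => ?_
        rw [← mem_antidiagonal.1 hij, pow_add]
        ring

/-- `K` bounds the weighted norm `∑ ‖c_n‖ x ^ n` of the power series with coefficients `c_n`; this
is expressed by the partial sums, so that it entails convergence. -/
def NormLE (P : A⟦X⟧) (x K : ℝ) : Prop :=
  ∀ N, ∑ n ∈ range N, ‖coeff n P‖ * x ^ n ≤ K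

theorem NormLE.nonneg (h : NormLE P x K) : 0 ≤ K := by
  simpa using h 0

theorem NormLE.summable (hx : 0 ≤ x) (h : NormLE P x K) : Summable fun n => ‖coeff n P‖ * x ^ n :=
  summable_of_sum_range_le (fun _ => by positivity) h

theorem NormLE.mono (h : NormLE P x K) (hKL : K ≤ L) : NormLE P x L :=
  fun N => (h N).trans hKL

theorem NormLE.anti (h : NormLE P y K) (hx : 0 ≤ x) (hxy : x ≤ y) : NormLE P x K :=
  fun N => (sum_le_sum fun n _ => by gcongr).trans (h N)

theorem NormLE.zero (x : ℝ) : NormLE (0 : A⟦X⟧) x 0 := fun N => by simp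

theorem NormLE.C (c : A) (x : ℝ) : NormLE (C c) x ‖c‖ := by
  rintro (_ | N)
  · simp
  · simp [sum_range_succ', coeff_C]

theorem NormLE.add (hx : 0 ≤ x) (hP : NormLE P x K) (hQ : NormLE Q x L) :
    NormLE (P + Q) x (K + L) := fun N => by
  refine le_trans (sum_le_sum fun n _ => ?_)
    ((sum_add_distrib ..).trans_le (add_le_add (hP N) (hQ N)))
  rw [map_add, ← add_mul]
  gcongr
  exact norm_add_le _ _

theorem NormLE.sub (hx : 0 ≤ x) (hP : NormLE P x K) (hQ : NormLE Q x L) :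
    NormLE (P - Q) x (K + L) := by
  rw [sub_eq_add_neg]
  exact hP.add hx fun N => by simpa using hQ N

theorem NormLE.sum {J : Type*} {s : Finset J} {P : J → A⟦X⟧} {K : J → ℝ} (hx : 0 ≤ x)
    (h : ∀ j ∈ s, NormLE (P j) x (K j)) : NormLE (∑ j ∈ s, P j) x (∑ j ∈ s, K j) := by
  classical
  induction s using Finset.induction_on with
  | empty => exact NormLE.zero x
  | insert j s hj ih =>
    rw [sum_insert hj, sum_insert hj]
    exact (h j (mem_insert_self j s)).add hx (ih fun i hi => h i (mem_insert_of_mem hi))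

theorem NormLE.mul (hx : 0 ≤ x) (hP : NormLE P x K) (hQ : NormLE Q x L) :
    NormLE (P * Q) x (K * L) := fun N =>
  (sum_norm_coeff_mul_le P Q hx N).trans
    (mul_le_mul (hP N) (hQ N) (sum_nonneg fun _ _ => by positivity) hP.nonneg)

theorem NormLE.X_mul (hx : 0 ≤ x) (hP : NormLE P x K) : NormLE (X * P) x (x * K) := by
  rintro (_ | N)
  · simpa using mul_nonneg hx hP.nonneg
  · calc ∑ n ∈ range (N + 1), ‖coeff n (X * P)‖ * x ^ n
        = x * ∑ n ∈ range N, ‖coeff n P‖ * x ^ n := by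
          simp [sum_range_succ', coeff_succ_X_mul, mul_sum, pow_succ', mul_left_comm]
      _ ≤ x * K := by gcongr; exact hP N

section NormOneClass

variable [NormOneClass A]

theorem NormLE.one (x : ℝ) : NormLE (1 : A⟦X⟧) x 1 := by
  simpa using NormLE.C (1 : A) x

theorem NormLE.pow (hx : 0 ≤ x) (hP : NormLE P x K) (r : ℕ) : NormLE (P ^ r) x (K ^ r) := by
  induction r with
  | zero => simpa using NormLE.one x
  | succ r ih => simpa only [pow_succ] using ih.mul hx hP

theorem NormLE.list_prod (hx : 0 ≤ x) {l : List A⟦X⟧} (h : ∀ P ∈ l, NormLE P x K) :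
    NormLE l.prod x (K ^ l.length) := by
  induction l with
  | nil => simpa using NormLE.one x
  | cons P l ih =>
    rw [List.forall_mem_cons] at h
    simpa only [List.prod_cons, List.length_cons, pow_succ'] using h.1.mul hx (ih h.2)

end NormOneClass

variable [NormedAlgebra ℝ A]

theorem NormLE.smul (h : NormLE P x K) (c : ℝ) : NormLE (c • P) x (|c| * K) := fun N => by
  simp only [coeff_real_smul, norm_smul, Real.norm_eq_abs, mul_assoc, ← mul_sum]
  exact mul_le_mul_of_nonneg_left (h N) (abs_nonneg c)

theorem NormLE.dilate (hx : 0 ≤ x) (h : NormLE P x K) {c : ℝ} (hc : |c| ≤ 1) :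
    NormLE (dilate c P) x K := fun N => by
  refine (sum_le_sum fun n _ => ?_).trans (h N)
  rw [coeff_dilate, norm_smul, norm_pow, Real.norm_eq_abs]
  gcongr
  exact mul_le_of_le_one_left (norm_nonneg _) (pow_le_one₀ (abs_nonneg c) hc)

variable [NormOneClass A]

theorem NormLE.truncated_exp_X_mul (hx : 0 ≤ x) (h : NormLE P x K) (N : ℕ) :
    NormLE (∑ n ∈ range N, (n.factorial : ℝ)⁻¹ • (X * P) ^ n) x (Real.exp (x * K)) := by
  refine (NormLE.sum hx fun n _ => (((h.X_mul hx).pow hx n).smul _)).mono ?_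
  simpa [div_eq_inv_mul] using Real.sum_le_exp_of_nonneg (mul_nonneg hx h.nonneg) N

theorem NormLE.expXMul (hx : 0 ≤ x) (h : NormLE P x K) :
    NormLE (expXMul P) x (Real.exp (x * K)) := fun N => by
  refine (sum_congr rfl fun n hn => ?_).trans_le (h.truncated_exp_X_mul hx N N)
  rw [coeff_expXMul P (mem_range.1 hn)]

theorem NormLE.expSeries (hx : 0 ≤ x) (c : A) : NormLE (expSeries c) x (Real.exp (x * ‖c‖)) :=
  expXMul_C c ▸ (NormLE.C c x).expXMul hx

theorem NormLE.evolutionSeries (hx : 0 ≤ x) (h : NormLE P x K) :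
    NormLE (evolutionSeries P) x (Real.exp (x * K)) := by
  set c := fun n => coeff n (MPF.evolutionSeries P)
  set S : ℕ → ℝ → ℝ := fun N s => ∑ n ∈ range N, ‖c n‖ * s ^ n
  have S_nonneg (N : ℕ) {s : ℝ} (hs : 0 ≤ s) : 0 ≤ S N s := sum_nonneg fun n _ => by positivity
  have S_le_succ (N : ℕ) {s : ℝ} (hs : 0 ≤ s) : S N s ≤ S (N + 1) s :=
    sum_le_sum_of_subset_of_nonneg (range_mono N.le_succ) fun n _ _ => by positivity
  intro N
  set S' : ℝ → ℝ := fun s => ∑ n ∈ range N, ‖coeff n (P * MPF.evolutionSeries P)‖ * s ^ n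
  have S'_le {s : ℝ} (hs : s ∈ Set.Ico 0 x) : ‖S' s‖ ≤ K * ‖S (N + 1) s‖ := by
    rw [Real.norm_of_nonneg (sum_nonneg fun n _ => by have := hs.1; positivity),
      Real.norm_of_nonneg (S_nonneg _ hs.1)]
    exact (sum_norm_coeff_mul_le _ _ hs.1 N).trans (mul_le_mul (h.anti hs.1 hs.2.le N)
      (S_le_succ N hs.1) (S_nonneg N hs.1) h.nonneg)
  have deriv_S (s : ℝ) : HasDerivAt (S (N + 1)) (S' s) s := by
    have term (n : ℕ) : HasDerivAt (fun s => ‖c (n + 1)‖ * s ^ (n + 1))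
        (‖coeff n (P * MPF.evolutionSeries P)‖ * s ^ n) s := by
      refine ((hasDerivAt_pow (n + 1) s).const_mul ‖c (n + 1)‖).congr_deriv ?_
      rw [← formalDeriv_evolutionSeries, coeff_formalDeriv, norm_smul,
        Real.norm_of_nonneg (by positivity)]
      push_cast [Nat.add_sub_cancel]
      ring
    simp only [S, sum_range_succ' _ N, pow_zero]
    exact (HasDerivAt.fun_sum fun n _ => term n).add_const _
  have S_zero : ‖S (N + 1) 0‖ ≤ 1 := by
    simp [S, c, sum_range_succ', constantCoeff_evolutionSeries]
  have gronwall := norm_le_gronwallBound_of_norm_deriv_right_le (ε := 0)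
    (fun s _ => (deriv_S s).continuousAt.continuousWithinAt)
    (fun s _ => (deriv_S s).hasDerivWithinAt) S_zero
    (fun s hs => by simpa using S'_le hs) x ⟨hx, le_rfl⟩
  rw [gronwallBound_ε0, one_mul, sub_zero, mul_comm] at gronwall
  exact (S_le_succ N hx).trans ((le_abs_self _).trans gronwall)

end WeightedNorm

section Evaluation

open PowerSeries Finset

variable {A : Type*} [NormedRing A] [NormedAlgebra ℝ A] {P Q : A⟦X⟧} {x R K L : ℝ}

/-- The value at `x` of a power series, for use on series with `NormLE P R K` and `|x| ≤ R`: there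
is no convergence requirement in the definition. -/
noncomputable def evalAt (P : A⟦X⟧) (x : ℝ) : A := ∑' n, x ^ n • coeff n P

theorem evalAt_C (c : A) (x : ℝ) : evalAt (C c) x = c := by
  rw [evalAt, tsum_eq_single 0 fun n hn => by rw [coeff_C_of_ne_zero hn, smul_zero]]
  simp

theorem evalAt_zero_right (P : A⟦X⟧) : evalAt P 0 = constantCoeff P := by
  rw [evalAt, tsum_eq_single 0 fun n hn => by rw [zero_pow hn, zero_smul]]
  simp

theorem evalAt_dilate (c : ℝ) (P : A⟦X⟧) (x : ℝ) : evalAt (dilate c P) x = evalAt P (c * x) := by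
  simp only [evalAt, coeff_dilate, smul_smul, mul_pow, mul_comm]

theorem evalAt_smul (c : ℝ) (P : A⟦X⟧) (x : ℝ) : evalAt (c • P) x = c • evalAt P x := by
  simp only [evalAt, coeff_real_smul, smul_comm _ c, tsum_const_smul'']

theorem NormLE.summable_norm (h : NormLE P R K) (hx : |x| ≤ R) :
    Summable fun n => ‖x ^ n • coeff n P‖ := by
  simpa only [norm_smul, norm_pow, Real.norm_eq_abs, mul_comm] using
    (h.anti (abs_nonneg x) hx).summable (abs_nonneg x)

theorem eq_zero_of_pow_smul_isBigO {c : A} {n : ℕ}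
    (h : (fun x : ℝ => x ^ n • c) =O[𝓝[>] 0] fun x => x ^ (n + 1)) : c = 0 := by
  have const_isBigO : (fun _ : ℝ => c) =O[𝓝[>] 0] fun x => x := by
    refine ((Asymptotics.isBigO_refl (fun x : ℝ => (x ^ n)⁻¹) _).smul h).congr' ?_ ?_ <;>
      filter_upwards [self_mem_nhdsWithin] with x (hx : 0 < x)
    · rw [inv_smul_smul₀ (by positivity)]
    · rw [smul_eq_mul, pow_succ, inv_mul_cancel_left₀ (by positivity)]
  exact tendsto_nhds_unique tendsto_const_nhds
    (const_isBigO.trans_tendsto (tendsto_id.mono_left nhdsWithin_le_nhds))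

variable [CompleteSpace A]

theorem NormLE.hasSum_evalAt (h : NormLE P R K) (hx : |x| ≤ R) :
    HasSum (fun n => x ^ n • coeff n P) (evalAt P x) :=
  (h.summable_norm hx).of_norm.hasSum

theorem NormLE.evalAt_sub (hP : NormLE P R K) (hQ : NormLE Q R L) (hx : |x| ≤ R) :
    evalAt (P - Q) x = evalAt P x - evalAt Q x := by
  simpa only [evalAt, map_sub, smul_sub] using
    ((hP.hasSum_evalAt hx).sub (hQ.hasSum_evalAt hx)).tsum_eq

theorem evalAt_sum {J : Type*} {s : Finset J} {P : J → A⟦X⟧} {K : J → ℝ}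
    (h : ∀ j ∈ s, NormLE (P j) R (K j)) (hx : |x| ≤ R) :
    evalAt (∑ j ∈ s, P j) x = ∑ j ∈ s, evalAt (P j) x := by
  simpa only [evalAt, map_sum, smul_sum] using
    (hasSum_sum fun j hj => (h j hj).hasSum_evalAt hx).tsum_eq

theorem NormLE.evalAt_mul (hP : NormLE P R K) (hQ : NormLE Q R L) (hx : |x| ≤ R) :
    evalAt (P * Q) x = evalAt P x * evalAt Q x := by
  rw [evalAt, evalAt, evalAt, tsum_mul_tsum_eq_tsum_sum_antidiagonal_of_summable_norm
    (hP.summable_norm hx) (hQ.summable_norm hx)]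
  refine tsum_congr fun n => ?_
  rw [coeff_mul, smul_sum]
  refine sum_congr rfl fun ij hij => ?_
  rw [smul_mul_smul_comm, ← pow_add, HasAntidiagonal.mem_antidiagonal.1 hij]

theorem NormLE.evalAt_X_mul (h : NormLE P R K) (hx : |x| ≤ R) :
    evalAt (X * P) x = x • evalAt P x := by
  have shifted : HasSum (fun n => x ^ (n + 1) • coeff (n + 1) (X * P)) (x • evalAt P x) := by
    simpa only [coeff_succ_X_mul, smul_smul, pow_succ'] using (h.hasSum_evalAt hx).const_smul x
  exact ((hasSum_nat_add_iff (f := fun n => x ^ n • coeff n (X * P)) 1).1 shifted).tsum_eq.trans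
    (by simp)

theorem NormLE.norm_evalAt_sub_sum_le (h : NormLE P R K) (hR : 0 < R) (hx : |x| ≤ R) (N : ℕ) :
    ‖evalAt P x - ∑ n ∈ range N, x ^ n • coeff n P‖ ≤ (|x| / R) ^ N * K := by
  have tail := (hasSum_nat_add_iff' N).2 (h.hasSum_evalAt hx)
  have majorant (n : ℕ) : ‖x ^ (n + N) • coeff (n + N) P‖ ≤
      (|x| / R) ^ N * (‖coeff (n + N) P‖ * R ^ (n + N)) := by
    rw [norm_smul, norm_pow, Real.norm_eq_abs, pow_add, div_pow, pow_add]
    calc |x| ^ n * |x| ^ N * ‖coeff (n + N) P‖ ≤ R ^ n * |x| ^ N * ‖coeff (n + N) P‖ := by gcongr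
      _ = _ := by field_simp
  refine le_of_tendsto' tail.tendsto_sum_nat.norm fun m => (norm_sum_le_of_le _ fun n _ =>
    majorant n).trans ?_
  rw [← mul_sum]
  gcongr
  refine le_trans ?_ (h (m + N))
  rw [add_comm m, sum_range_add]
  simp only [add_comm N]
  exact le_add_of_nonneg_left (sum_nonneg fun _ _ => by positivity)

theorem NormLE.norm_evalAt_le_of_coeff_eq_zero (h : NormLE P R K) (hR : 0 < R)
    (hx : |x| ≤ R) {N : ℕ} (hN : ∀ n < N, coeff n P = 0) : ‖evalAt P x‖ ≤ (|x| / R) ^ N * K := by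
  have := h.norm_evalAt_sub_sum_le hR hx N
  rwa [sum_eq_zero fun n hn => by rw [hN n (mem_range.1 hn), smul_zero], sub_zero] at this

theorem NormLE.coeff_eq_zero_of_isBigO (h : NormLE P R K) (hR : 0 < R) {N : ℕ}
    (hO : evalAt P =O[𝓝[>] 0] fun x => x ^ N) {n : ℕ} (hn : n < N) : coeff n P = 0 := by
  induction n using Nat.strong_induction_on with
  | _ n ih =>
    have small : ∀ᶠ x : ℝ in 𝓝[>] 0, x ∈ Set.Ioc 0 R := Ioc_mem_nhdsGT hR
    have remainder : (fun x => evalAt P x - x ^ n • coeff n P) =O[𝓝[>] 0] fun x => x ^ (n + 1) := by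
      refine .of_bound (K / R ^ (n + 1)) ?_
      filter_upwards [small] with x hx
      have := h.norm_evalAt_sub_sum_le hR ((abs_of_pos hx.1).trans_le hx.2) (n + 1)
      rw [sum_range_succ, sum_eq_zero fun m hm => by
        rw [ih m (mem_range.1 hm) ((mem_range.1 hm).trans hn), smul_zero], zero_add, div_pow,
        div_mul_comm] at this
      simpa using this
    have lower_order : (fun x : ℝ => x ^ N) =O[𝓝[>] 0] fun x => x ^ (n + 1) := by
      refine .of_bound' ?_
      filter_upwards [Ioc_mem_nhdsGT one_pos] with x hx
      rw [norm_pow, norm_pow]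
      exact pow_le_pow_of_le_one (norm_nonneg x) ((abs_of_pos hx.1).trans_le hx.2) hn
    exact eq_zero_of_pow_smul_isBigO <| by
      simpa using (hO.trans lower_order).sub remainder

theorem NormLE.hasDerivAt_evalAt (h : NormLE P R K) (h' : NormLE (formalDeriv P) R L)
    (hx : |x| < R) : HasDerivAt (evalAt P) (evalAt (formalDeriv P) x) x := by
  have mem_ball (y : ℝ) : y ∈ Metric.ball 0 R ↔ |y| < R := by
    rw [mem_ball_zero_iff, Real.norm_eq_abs]
  have term (n : ℕ) (y : ℝ) : HasDerivAt (fun y : ℝ => y ^ (n + 1) • coeff (n + 1) P)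
      (y ^ n • coeff n (formalDeriv P)) y := by
    refine ((hasDerivAt_pow (n + 1) y).smul_const _).congr_deriv ?_
    rw [coeff_formalDeriv, smul_smul, mul_comm, Nat.add_sub_cancel, Nat.cast_succ]
  have key := hasDerivAt_tsum_of_isPreconnected (h'.summable ((abs_nonneg x).trans hx.le))
    Metric.isOpen_ball (convex_ball (0 : ℝ) R).isPreconnected (fun n y _ => term n y)
    (fun n y hy => ?_) ((mem_ball x).2 hx)
    ((summable_nat_add_iff 1).2 (h.hasSum_evalAt hx.le).summable) ((mem_ball x).2 hx)
  · refine (key.const_add (coeff 0 P)).congr_of_eventuallyEq ?_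
    filter_upwards [Metric.isOpen_ball.mem_nhds ((mem_ball x).2 hx)] with y hy
    rw [evalAt, (h.hasSum_evalAt ((mem_ball y).1 hy).le).summable.tsum_eq_zero_add, pow_zero,
      one_smul]
  · rw [norm_smul, norm_pow, Real.norm_eq_abs, mul_comm]
    gcongr
    exact ((mem_ball y).1 hy).le

variable [NormOneClass A]

theorem NormLE.evalAt_pow (h : NormLE P R K) (hx : |x| ≤ R) (r : ℕ) :
    evalAt (P ^ r) x = evalAt P x ^ r := by
  have hR := (abs_nonneg x).trans hx
  induction r with
  | zero => simpa using evalAt_C (1 : A) x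
  | succ r ih => rw [pow_succ, pow_succ, (h.pow hR r).evalAt_mul h hx, ih]

theorem evalAt_list_prod {l : List A⟦X⟧} (h : ∀ P ∈ l, NormLE P R K) (hx : |x| ≤ R) :
    evalAt l.prod x = (l.map (evalAt · x)).prod := by
  have hR := (abs_nonneg x).trans hx
  induction l with
  | nil => simpa using evalAt_C (1 : A) x
  | cons P l ih =>
    rw [List.forall_mem_cons] at h
    rw [List.prod_cons, h.1.evalAt_mul (NormLE.list_prod hR h.2) hx, ih h.2, List.map_cons,
      List.prod_cons]

theorem NormLE.evalAt_truncated_exp_X_mul (h : NormLE P R K) (hx : |x| ≤ R) (N : ℕ) :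
    evalAt (∑ n ∈ range N, (n.factorial : ℝ)⁻¹ • (X * P) ^ n) x =
      ∑ n ∈ range N, (n.factorial : ℝ)⁻¹ • (x • evalAt P x) ^ n := by
  have hR := (abs_nonneg x).trans hx
  rw [evalAt_sum (fun n _ => ((h.X_mul hR).pow hR n).smul _) hx]
  refine sum_congr rfl fun n _ => ?_
  rw [evalAt_smul, (h.X_mul hR).evalAt_pow hx, h.evalAt_X_mul hx]

theorem NormLE.evalAt_expXMul (h : NormLE P R K) (hx : |x| < R) :
    evalAt (MPF.expXMul P) x = NormedSpace.exp (x • evalAt P x) := by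
  have hR := (abs_nonneg x).trans_lt hx
  set T : ℕ → A⟦X⟧ := fun N => ∑ n ∈ range N, (n.factorial : ℝ)⁻¹ • (X * P) ^ n
  have limit : Tendsto (fun N => evalAt (T N) x) atTop (𝓝 (NormedSpace.exp (x • evalAt P x))) := by
    simpa only [T, h.evalAt_truncated_exp_X_mul hx.le] using
      (NormedSpace.exp_series_hasSum_exp' (𝕂 := ℝ) (x • evalAt P x)).tendsto_sum_nat
  have error_le (N : ℕ) : ‖evalAt (T N) x - evalAt (MPF.expXMul P) x‖ ≤
      (|x| / R) ^ N * (Real.exp (R * K) + Real.exp (R * K)) := by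
    have hT := h.truncated_exp_X_mul hR.le N
    have hE := h.expXMul hR.le
    rw [← hT.evalAt_sub hE hx.le]
    refine (hT.sub hR.le hE).norm_evalAt_le_of_coeff_eq_zero hR hx.le fun n hn => ?_
    rw [map_sub, coeff_expXMul P hn, sub_self]
  have error_tendsto : Tendsto
      (fun N => (|x| / R) ^ N * (Real.exp (R * K) + Real.exp (R * K))) atTop (𝓝 0) := by
    simpa using (tendsto_pow_atTop_nhds_zero_of_lt_one (by positivity)
      ((div_lt_one hR).2 hx)).mul_const (Real.exp (R * K) + Real.exp (R * K))
  exact tendsto_nhds_unique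
    (tendsto_iff_norm_sub_tendsto_zero.2 (squeeze_zero (fun _ => norm_nonneg _) error_le
      error_tendsto)) limit

theorem evalAt_expSeries (c : A) (x : ℝ) : evalAt (expSeries c) x = NormedSpace.exp (x • c) := by
  rw [← expXMul_C, (NormLE.C c (|x| + 1)).evalAt_expXMul (lt_add_one _), evalAt_C]

end Evaluation

section Multiproduct

open PowerSeries Finset

variable {A : Type*} [NormedRing A] [NormedAlgebra ℝ A] [NormOneClass A]

theorem exists_normLE_strangSeries (h : ℝ) (y z : A) {x : ℝ} (hx : 0 ≤ x) :
    ∃ K, NormLE (strangSeries h y z) x K :=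
  ⟨_, ((NormLE.expSeries hx _).mul hx (NormLE.expSeries hx _)).mul hx (NormLE.expSeries hx _)⟩

variable {J : Type*} [Fintype J]

theorem exists_normLE_errorSeries (a : J → ℝ) (k : J → ℕ) (y z : A) {x : ℝ} (hx : 0 ≤ x) :
    ∃ K, NormLE (errorSeries a k y z) x K := by
  choose K hK using fun j => exists_normLE_strangSeries (k j : ℝ)⁻¹ y z hx
  exact ⟨_, (NormLE.sum hx fun j _ => ((hK j).pow hx (k j)).smul (a j)).sub hx
    (NormLE.expSeries hx (y + z))⟩

variable [CompleteSpace A]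

theorem evalAt_strangSeries (h : ℝ) (y z : A) (t : ℝ) :
    evalAt (strangSeries h y z) t =
      NormedSpace.exp (t • (h / 2) • y) * NormedSpace.exp (t • h • z) *
        NormedSpace.exp (t • (h / 2) • y) := by
  have exp_normLE (c : A) := NormLE.expSeries (abs_nonneg t) c
  rw [strangSeries, ((exp_normLE _).mul (abs_nonneg t) (exp_normLE _)).evalAt_mul (exp_normLE _)
    le_rfl, (exp_normLE _).evalAt_mul (exp_normLE _) le_rfl, evalAt_expSeries, evalAt_expSeries]

theorem evalAt_errorSeries (a : J → ℝ) (k : J → ℕ) (y z : A) (t : ℝ) :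
    evalAt (errorSeries a k y z) t =
      ∑ j, a j • evalAt (strangSeries (k j : ℝ)⁻¹ y z) t ^ k j -
        NormedSpace.exp (t • (y + z)) := by
  choose K hK using fun j => exists_normLE_strangSeries (k j : ℝ)⁻¹ y z (abs_nonneg t)
  have term_normLE (j : J) := ((hK j).pow (abs_nonneg t) (k j)).smul (a j)
  rw [errorSeries, (NormLE.sum (abs_nonneg t) fun j _ => term_normLE j).evalAt_sub
    (NormLE.expSeries (abs_nonneg t) _) le_rfl, evalAt_expSeries,
    evalAt_sum (fun j _ => term_normLE j) le_rfl]
  simp only [evalAt_smul, (hK _).evalAt_pow le_rfl]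

variable {d : ℕ}

theorem trotter2_mul_eq_evalAt [NeZero d] (A : Fin 2 → Op d) (t h : ℝ) :
    trotter2 A (t * h) = evalAt (strangSeries h (-Complex.I • A 0) (-Complex.I • A 1)) t := by
  let : NormedAlgebra ℚ (Op d) := NormedAlgebra.restrictScalars ℚ ℂ (Op d)
  have generator (s : ℝ) (B : Op d) : s • -Complex.I • B = (-Complex.I * (s : ℂ)) • B := by
    rw [← Complex.coe_smul, smul_smul, mul_comm]
  have half_add_half : t * h = t * h / 2 + t * h / 2 := by ring
  rw [evalAt_strangSeries, smul_smul, smul_smul, ← mul_div_assoc, generator, half_add_half,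
    add_smul, NormedSpace.exp_add_of_commute (Commute.refl _), generator, ← half_add_half]
  simp [trotter2, mul_assoc]

theorem timeIndependentMPF_sub_exp [NeZero d] {M : ℕ} (a : Fin M → ℝ) (k : Fin M → ℕ)
    (A : Fin 2 → Op d) (t : ℝ) :
    timeIndependentMPF a k A t - NormedSpace.exp ((-Complex.I * (t : ℂ)) • ∑ l, A l) =
      evalAt (errorSeries a k (-Complex.I • A 0) (-Complex.I • A 1)) t := by
  simp only [evalAt_errorSeries, timeIndependentMPF, ← trotter2_mul_eq_evalAt, ← div_eq_mul_inv,
    Complex.coe_smul, Fin.sum_univ_two, ← smul_add]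
  rw [← Complex.coe_smul t, smul_smul, mul_comm]

theorem IsMPFData.orderConditions {M : ℕ} {a : Fin M → ℝ} {k : Fin M → ℕ} (h : IsMPFData a k) :
    OrderConditions a k (2 * M + 1) := by
  intro n hn
  have generators : Set.range (FreeAlgebra.ι ℝ : Fin 2 → FreeAlgebra ℝ (Fin 2)) =
      {FreeAlgebra.ι ℝ 0, FreeAlgebra.ι ℝ 1} := by
    ext z
    simp only [Set.mem_range, Fin.exists_fin_two, Set.mem_insert_iff, Set.mem_singleton_iff,
      eq_comm]
  refine eq_zero_of_lift_smul_pathMatrix (c := -Complex.I) (n := n) ?_ (by simp) fun w => ?_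
  · rw [generators]
    exact coeff_errorSeries_mem a k _ _ n
  · obtain ⟨K, hK⟩ := exists_normLE_errorSeries a k (-Complex.I • pathMatrix w 0)
      (-Complex.I • pathMatrix w 1) zero_le_one
    rw [lift_coeff_errorSeries]
    refine hK.coeff_eq_zero_of_isBigO one_pos ?_ hn
    simpa only [timeIndependentMPF_sub_exp] using
      h.2 (n + 1) 2 (pathMatrix w) (isHermitian_pathMatrix w)

end Multiproduct

section Taylor

open PowerSeries Finset

variable {A : Type*} [NormedRing A] [NormedAlgebra ℝ A] {f : ℝ → A} {I : Set ℝ} {t₀ t₁ t x L : ℝ}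

/-- All derivatives of `f` on `I` are controlled by the single scale `L`, in the normalization in
which `sup ‖∂ᵖ f‖ ^ (1 / (p + 1))` is the least scale. -/
def DerivScaleLE (f : ℝ → A) (I : Set ℝ) (L : ℝ) : Prop :=
  ∀ p, ∀ t ∈ I, ‖iteratedDerivWithin p f I t‖ ≤ L ^ (p + 1)

theorem DerivScaleLE.norm_le (h : DerivScaleLE f I L) (ht : t ∈ I) : ‖f t‖ ≤ L := by
  simpa using h 0 t ht

/-- The Taylor series of `f` at `t₀`, with derivatives within `I`, in the variable `t - t₀`. -/
noncomputable def taylorSeries (f : ℝ → A) (I : Set ℝ) (t₀ : ℝ) : A⟦X⟧ :=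
  mk fun p => taylorCoeffWithin f p I t₀

theorem DerivScaleLE.normLE_taylorSeries (h : DerivScaleLE f I L) (ht₀ : t₀ ∈ I) (hx : 0 ≤ x) :
    NormLE (taylorSeries f I t₀) x (L * Real.exp (L * x)) := fun N => by
  have hL : 0 ≤ L := (norm_nonneg _).trans (h.norm_le ht₀)
  calc ∑ n ∈ range N, ‖coeff n (taylorSeries f I t₀)‖ * x ^ n
      ≤ ∑ n ∈ range N, L * ((L * x) ^ n / n.factorial) := by
        refine sum_le_sum fun n _ => ?_
        rw [taylorSeries, coeff_mk, taylorCoeffWithin, norm_smul, norm_inv, Real.norm_natCast]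
        calc (n.factorial : ℝ)⁻¹ * ‖iteratedDerivWithin n f I t₀‖ * x ^ n
            ≤ (n.factorial : ℝ)⁻¹ * L ^ (n + 1) * x ^ n := by gcongr; exact h n t₀ ht₀
          _ = L * ((L * x) ^ n / n.factorial) := by rw [mul_pow]; ring
    _ ≤ L * Real.exp (L * x) := by
        rw [← mul_sum]
        exact mul_le_mul_of_nonneg_left (Real.sum_le_exp_of_nonneg (mul_nonneg hL hx) N) hL

theorem DerivScaleLE.tendsto_taylorWithinEval (h : DerivScaleLE f (Icc t₀ t₁) L)
    (hf : ContDiffOn ℝ (⊤ : ℕ∞) f (Icc t₀ t₁)) (ht : t ∈ Icc t₀ t₁) :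
    Tendsto (fun n => taylorWithinEval f n (Icc t₀ t₁) t₀ t) atTop (𝓝 (f t)) := by
  have remainder_tendsto : Tendsto
      (fun n : ℕ => L ^ 2 * (t - t₀) * ((L * (t - t₀)) ^ n / n.factorial)) atTop (𝓝 0) := by
    simpa using (FloorSemiring.tendsto_pow_div_factorial_atTop (L * (t - t₀))).const_mul
      (L ^ 2 * (t - t₀))
  refine tendsto_iff_norm_sub_tendsto_zero.2
    (squeeze_zero (fun n => norm_nonneg _) (fun n => ?_) remainder_tendsto)
  rw [norm_sub_rev]
  refine (taylor_mean_remainder_bound (ht.1.trans ht.2) (hf.of_le (mod_cast le_top)) ht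
    (h (n + 1))).trans_eq ?_
  rw [mul_pow]
  ring

variable [CompleteSpace A]

theorem DerivScaleLE.evalAt_taylorSeries (h : DerivScaleLE f (Icc t₀ t₁) L)
    (hf : ContDiffOn ℝ (⊤ : ℕ∞) f (Icc t₀ t₁)) (ht : t ∈ Icc t₀ t₁) :
    evalAt (taylorSeries f (Icc t₀ t₁) t₀) (t - t₀) = f t := by
  have partial_sum (n : ℕ) : ∑ p ∈ range (n + 1),
      (t - t₀) ^ p • coeff p (taylorSeries f (Icc t₀ t₁) t₀) =
        taylorWithinEval f n (Icc t₀ t₁) t₀ t := by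
    simp only [taylor_within_apply, taylorSeries, coeff_mk, taylorCoeffWithin, smul_smul, mul_comm]
  have hasSum := (h.normLE_taylorSeries (left_mem_Icc.2 (ht.1.trans ht.2))
    (sub_nonneg.2 ht.1)).hasSum_evalAt (abs_of_nonneg (sub_nonneg.2 ht.1)).le
  exact tendsto_nhds_unique (hasSum.tendsto_sum_nat.comp (tendsto_add_atTop_nat 1))
    (by simpa only [Function.comp_def, partial_sum] using h.tendsto_taylorWithinEval hf ht)

end Taylor

section LinearODE

open PowerSeries

variable {A : Type*} [NormedRing A] [NormedAlgebra ℝ A] {f u v : ℝ → A} {t₀ t₁ t K L : ℝ}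

theorem eqOn_of_hasDerivWithinAt_mul (hK : ∀ t ∈ Icc t₀ t₁, ‖f t‖ ≤ K)
    (hu : ∀ t ∈ Icc t₀ t₁, HasDerivWithinAt u (f t * u t) (Icc t₀ t₁) t)
    (hv : ∀ t ∈ Icc t₀ t₁, HasDerivWithinAt v (f t * v t) (Icc t₀ t₁) t) (h₀ : u t₀ = v t₀) :
    EqOn u v (Icc t₀ t₁) := by
  have right_deriv {w : ℝ → A} (hw : ∀ t ∈ Icc t₀ t₁, HasDerivWithinAt w (f t * w t) (Icc t₀ t₁) t)
      (t : ℝ) (ht : t ∈ Ico t₀ t₁) : HasDerivWithinAt w (f t * w t) (Ici t) t :=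
    (hw t (Ico_subset_Icc_self ht)).mono_of_mem_nhdsWithin
      (mem_of_superset (Icc_mem_nhdsGE ht.2) (Icc_subset_Icc_left ht.1))
  refine ODE_solution_unique_of_mem_Icc_right (v := fun t z => f t * z) (s := fun _ => univ)
    (K := K.toNNReal) (fun t ht => LipschitzOnWith.of_dist_le_mul fun y _ z _ => ?_)
    (fun t ht => (hu t ht).continuousWithinAt) (right_deriv hu) (fun _ _ => mem_univ _)
    (fun t ht => (hv t ht).continuousWithinAt) (right_deriv hv) (fun _ _ => mem_univ _) h₀
  rw [dist_eq_norm, dist_eq_norm, ← mul_sub]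
  refine (norm_mul_le _ _).trans (mul_le_mul_of_nonneg_right ?_ (norm_nonneg _))
  exact (hK t (Ico_subset_Icc_self ht)).trans (Real.le_coe_toNNReal K)

variable [NormOneClass A] [CompleteSpace A]

theorem DerivScaleLE.eq_evalAt_evolutionSeries (h : DerivScaleLE f (Icc t₀ t₁) L)
    (hf : ContDiffOn ℝ (⊤ : ℕ∞) f (Icc t₀ t₁))
    (hu : ∀ t ∈ Icc t₀ t₁, HasDerivWithinAt u (f t * u t) (Icc t₀ t₁) t) (h₀ : u t₀ = 1)
    (ht : t ∈ Icc t₀ t₁) :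
    u t = evalAt (evolutionSeries (taylorSeries f (Icc t₀ t₁) t₀)) (t - t₀) := by
  set G := taylorSeries f (Icc t₀ t₁) t₀
  refine eqOn_of_hasDerivWithinAt_mul
    (v := fun τ => evalAt (evolutionSeries G) (τ - t₀)) (fun t ht => h.norm_le ht) hu
    (fun τ hτ => ?_) ?_ ht
  · have radius_nonneg : 0 ≤ τ - t₀ + 1 := by linarith [hτ.1]
    have lt_radius : |τ - t₀| < τ - t₀ + 1 := by
      rw [abs_of_nonneg (sub_nonneg.2 hτ.1)]
      exact lt_add_one _
    have hG := h.normLE_taylorSeries (left_mem_Icc.2 (hτ.1.trans hτ.2)) radius_nonneg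
    have hE := hG.evolutionSeries radius_nonneg
    have deriv_eq := hE.hasDerivAt_evalAt
      (formalDeriv_evolutionSeries G ▸ hG.mul radius_nonneg hE) lt_radius
    rw [formalDeriv_evolutionSeries, hG.evalAt_mul hE lt_radius.le,
      h.evalAt_taylorSeries hf hτ] at deriv_eq
    exact (deriv_eq.comp_sub_const τ t₀).hasDerivWithinAt
  · rw [h₀, sub_self, evalAt_zero_right, constantCoeff_evolutionSeries]

end LinearODE

section MidpointSeries

open PowerSeries

variable {A : Type*} [NormedRing A] [NormedAlgebra ℝ A] [NormOneClass A] {G : A⟦X⟧} {x h R K : ℝ}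
  {m : ℕ}

theorem abs_midpoint_le_one (hh : 0 ≤ h) (hm : m * h ≤ 1) {r : ℕ} (hr : r ∈ List.range m) :
    |((r : ℝ) + 1 / 2) * h| ≤ 1 := by
  have : (r : ℝ) + 1 ≤ m := mod_cast List.mem_range.1 hr
  rw [abs_of_nonneg (by positivity)]
  nlinarith

theorem NormLE.midpointFactor (hx : 0 ≤ x) (hG : NormLE G x K) (hh : 0 ≤ h) (hm : m * h ≤ 1)
    {r : ℕ} (hr : r ∈ List.range m) :
    NormLE (MPF.expXMul (h • MPF.dilate (((r : ℝ) + 1 / 2) * h) G)) x (Real.exp (x * (h * K))) := by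
  simpa only [abs_of_nonneg hh] using
    ((hG.dilate hx (abs_midpoint_le_one hh hm hr)).smul h).expXMul hx

theorem NormLE.midpointSeries (hx : 0 ≤ x) (hG : NormLE G x K) (hh : 0 ≤ h) (hm : m * h ≤ 1) :
    NormLE (MPF.midpointSeries G h m) x (Real.exp (x * K)) := by
  refine (NormLE.list_prod (K := Real.exp (x * (h * K))) hx ?_).mono ?_
  · simp only [List.mem_reverse, List.forall_mem_map]
    exact fun r hr => hG.midpointFactor hx hh hm hr
  · rw [List.length_reverse, List.length_map, List.length_range, ← Real.exp_nat_mul,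
      Real.exp_le_exp]
    calc m * (x * (h * K)) = (m * h) * (x * K) := by ring
      _ ≤ x * K := mul_le_of_le_one_left (mul_nonneg hx hG.nonneg) hm

theorem NormLE.evalAt_midpointSeries [CompleteSpace A] (hG : NormLE G R K) (hx : |x| < R)
    (hh : 0 ≤ h) (hm : m * h ≤ 1) :
    evalAt (MPF.midpointSeries G h m) x =
      ((List.range m).map fun r : ℕ =>
        NormedSpace.exp (x • h • evalAt G (((r : ℝ) + 1 / 2) * h * x))).reverse.prod := by
  have hR : 0 ≤ R := (abs_nonneg x).trans hx.le
  rw [MPF.midpointSeries, evalAt_list_prod (K := Real.exp (R * (h * K))) _ hx.le, List.map_reverse,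
    List.map_map]
  · congr 2
    refine List.map_congr_left fun r hr => ?_
    rw [Function.comp_apply,
      ((hG.dilate hR (abs_midpoint_le_one hh hm hr)).smul h).evalAt_expXMul hx, evalAt_smul,
      evalAt_dilate]
  · simp only [List.mem_reverse, List.forall_mem_map]
    exact fun r hr => hG.midpointFactor hR hh hm hr

end MidpointSeries

section FormalError

open PowerSeries Finset

variable {A : Type*} [NormedRing A] [NormedAlgebra ℝ A] [NormOneClass A] [CompleteSpace A]
  {J : Type*} [Fintype J] {a : J → ℝ} {k : J → ℕ} {N : ℕ} {G : A⟦X⟧} {x R K : ℝ}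

theorem OrderConditions.norm_sum_evalAt_midpointSeries_sub_le (h : OrderConditions a k N)
    (hN : 0 < N) (hk : ∀ j, 0 < k j) (hG : NormLE G R K) (hR : 0 < R) (hx : |x| ≤ R) :
    ‖∑ j, a j • evalAt (midpointSeries G (k j : ℝ)⁻¹ (k j)) x - evalAt (evolutionSeries G) x‖ ≤
      2 * Real.exp (R * K) * ((∑ j, |a j|) * (|x| / R) ^ N) := by
  set E := Real.exp (R * K)
  have step_normLE (j : J) : NormLE (midpointSeries G (k j : ℝ)⁻¹ (k j)) R E :=
    hG.midpointSeries hR.le (by positivity) mul_inv_le_one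
  have sum_normLE := NormLE.sum (s := univ) hR.le fun j _ => (step_normLE j).smul (a j)
  have evolution_normLE : NormLE (evolutionSeries G) R E := hG.evolutionSeries hR.le
  have error_bound := (sum_normLE.sub hR.le evolution_normLE).norm_evalAt_le_of_coeff_eq_zero hR hx
    fun n hn => by rw [map_sub, h.coeff_sum_midpointSeries hk G hn, sub_self]
  rw [sum_normLE.evalAt_sub evolution_normLE hx, evalAt_sum (fun j _ => (step_normLE j).smul _) hx,
    ← sum_mul] at error_bound
  simp only [evalAt_smul] at error_bound
  calc _ ≤ (|x| / R) ^ N * ((∑ j, |a j|) * E + E) := error_bound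
    _ ≤ (|x| / R) ^ N * ((∑ j, |a j|) * E + (∑ j, |a j|) * E) := by
      gcongr
      exact le_mul_of_one_le_left (Real.exp_pos _).le (h.one_le_sum_abs hN)
    _ = 2 * E * ((∑ j, |a j|) * (|x| / R) ^ N) := by ring

end FormalError

section Hamiltonian

variable {d : ℕ} {H : ℝ → Op d} {I : Set ℝ} {U : ℝ → ℝ → Op d} {t₀ t₁ t L : ℝ}

theorem derivScaleLE_Lam (hb : BddAbove (derivScales H I)) : DerivScaleLE H I (Lam H I) := by
  intro p t ht
  have root_le : ‖iteratedDerivWithin p H I t‖ ^ (1 / ((p : ℝ) + 1)) ≤ Lam H I :=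
    le_csSup hb ⟨t, ht, p, rfl⟩
  have := pow_le_pow_left₀ (by positivity) root_le (p + 1)
  rwa [← Real.rpow_natCast, ← Real.rpow_mul (norm_nonneg _), Nat.cast_succ,
    one_div_mul_cancel p.cast_add_one_ne_zero, Real.rpow_one] at this

theorem DerivScaleLE.neg_I_smul (h : DerivScaleLE H I L) :
    DerivScaleLE (fun t => -Complex.I • H t) I L := fun p t ht => by
  simpa only [iteratedDerivWithin_fun_const_smul_field, norm_smul, norm_neg, Complex.norm_I,
    one_mul] using h p t ht

theorem midpointSteps_eq_prod (H : ℝ → Op d) (k : ℕ) (t t₀ : ℝ) :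
    midpointSteps H k t t₀ = ((List.range k).map fun r : ℕ =>
      NormedSpace.exp ((-Complex.I * ((t - t₀) * (k : ℝ)⁻¹ : ℝ)) •
        H (((r : ℝ) + 1 / 2) * (k : ℝ)⁻¹ * (t - t₀) + t₀))).reverse.prod := by
  have step_length (r : ℕ) : t₀ + (t - t₀) * ((r + 1 : ℕ) : ℝ) / k - (t₀ + (t - t₀) * (r : ℝ) / k) =
      (t - t₀) * (k : ℝ)⁻¹ := by
    push_cast
    ring
  have node (r : ℕ) : t₀ + (t - t₀) * (r : ℝ) / k + (t - t₀) * (k : ℝ)⁻¹ / 2 =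
      ((r : ℝ) + 1 / 2) * (k : ℝ)⁻¹ * (t - t₀) + t₀ := by
    ring
  simp only [midpointSteps, midpoint, step_length, node]

theorem midpoint_mem_Icc (ht : t ∈ Icc t₀ t₁) {k r : ℕ} (hr : r ∈ List.range k) :
    ((r : ℝ) + 1 / 2) * (k : ℝ)⁻¹ * (t - t₀) + t₀ ∈ Icc t₀ t₁ := by
  have length_nonneg : 0 ≤ t - t₀ := sub_nonneg.2 ht.1
  have fraction_le_one : ((r : ℝ) + 1 / 2) * (k : ℝ)⁻¹ ≤ 1 :=
    (le_abs_self _).trans (abs_midpoint_le_one (by positivity) mul_inv_le_one hr)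
  have := mul_le_of_le_one_left length_nonneg fraction_le_one
  exact ⟨le_add_of_nonneg_left (by positivity), by linarith [ht.2]⟩

theorem midpointSteps_eq_evalAt [NeZero d]
    (h : DerivScaleLE (fun t => -Complex.I • H t) (Icc t₀ t₁) L)
    (hH : ContDiffOn ℝ (⊤ : ℕ∞) (fun t => -Complex.I • H t) (Icc t₀ t₁)) (ht : t ∈ Icc t₀ t₁)
    (k : ℕ) :
    midpointSteps H k t t₀ =
      evalAt (midpointSeries (taylorSeries (fun t => -Complex.I • H t) (Icc t₀ t₁) t₀)
        (k : ℝ)⁻¹ k) (t - t₀) := by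
  have radius_nonneg : 0 ≤ |t - t₀| + 1 := by positivity
  rw [midpointSteps_eq_prod, (h.normLE_taylorSeries (left_mem_Icc.2 (ht.1.trans ht.2))
    radius_nonneg).evalAt_midpointSeries (lt_add_one _) (by positivity) mul_inv_le_one]
  congr 2
  refine List.map_congr_left fun r hr => ?_
  have generator := h.evalAt_taylorSeries hH (midpoint_mem_Icc ht hr)
  rw [add_sub_cancel_right] at generator
  rw [generator, smul_smul, ← Complex.coe_smul, smul_smul, mul_comm]

theorem exp_mem_unitary {B : Op d} (hB : B.IsHermitian) (s : ℝ) :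
    NormedSpace.exp ((-Complex.I * (s : ℂ)) • B) ∈ unitary (Op d) := by
  have generator : (-Complex.I * (s : ℂ)) • B = Complex.I • (-s) • B := by
    rw [← Complex.coe_smul, smul_smul, Complex.ofReal_neg, mul_neg, neg_mul]
  rw [generator]
  exact (selfAdjoint.expUnitary ⟨(-s) • B, (IsSelfAdjoint.all (-s)).smul hB⟩).2

theorem midpointSteps_mem_unitary (hH : ∀ t ∈ Icc t₀ t₁, (H t).IsHermitian) (ht : t ∈ Icc t₀ t₁)
    (k : ℕ) : midpointSteps H k t t₀ ∈ unitary (Op d) := by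
  rw [midpointSteps_eq_prod]
  refine list_prod_mem ?_
  simp only [List.mem_reverse, List.forall_mem_map]
  exact fun r hr => exp_mem_unitary (hH _ (midpoint_mem_Icc ht hr)) _

theorem IsTimeEvolution.mem_unitary (hU : IsTimeEvolution H (Icc t₀ t₁) U)
    (hH : ∀ t ∈ Icc t₀ t₁, (H t).IsHermitian) (ht : t ∈ Icc t₀ t₁) : U t t₀ ∈ unitary (Op d) := by
  obtain ⟨initial, deriv⟩ := hU t₀ (left_mem_Icc.2 (ht.1.trans ht.2))
  have deriv_gram (t : ℝ) (ht : t ∈ Icc t₀ t₁) :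
      HasDerivWithinAt (fun t => star (U t t₀) * U t t₀) 0 (Icc t₀ t₁) t := by
    refine ((deriv t ht).star.fun_mul (deriv t ht)).congr_deriv ?_
    have star_H : star (H t) = H t := hH t ht
    simp [star_H, mul_assoc]
  have gram_const := constant_of_derivWithin_zero
    (fun t ht => (deriv_gram t ht).differentiableWithinAt)
    (fun t ht => (deriv_gram t (Ico_subset_Icc_self ht)).derivWithin
      (uniqueDiffOn_Icc (ht.1.trans_lt ht.2) t (Ico_subset_Icc_self ht))) t ht
  rw [initial, star_one, one_mul] at gram_const
  exact Matrix.mem_unitaryGroup_iff'.2 gram_const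

variable {M N : ℕ} {a : Fin M → ℝ} {k : Fin M → ℕ}

theorem norm_timeDependentMPF_sub_le_of_hermitian [NeZero d]
    (hU : IsTimeEvolution H (Icc t₀ t₁) U) (hH : ∀ t ∈ Icc t₀ t₁, (H t).IsHermitian)
    (ht : t ∈ Icc t₀ t₁) :
    ‖timeDependentMPF a k H t t₀ - U t t₀‖ ≤ ∑ j, |a j| + 1 := by
  refine (norm_sub_le _ _).trans (add_le_add (norm_sum_le_of_le _ fun j _ => ?_)
    (CStarRing.norm_of_mem_unitary (hU.mem_unitary hH ht)).le)
  rw [norm_smul, CStarRing.norm_of_mem_unitary (midpointSteps_mem_unitary hH ht _), mul_one,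
    Complex.norm_real, Real.norm_eq_abs]

theorem OrderConditions.norm_timeDependentMPF_sub_le_of_le_one [NeZero d]
    (h : OrderConditions a k N) (hN : 0 < N) (hk : ∀ j, 0 < k j) (hL : DerivScaleLE H (Icc t₀ t₁) L)
    (hL₀ : 0 < L) (hH : ContDiffOn ℝ (⊤ : ℕ∞) H (Icc t₀ t₁))
    (hU : IsTimeEvolution H (Icc t₀ t₁) U) (ht : t ∈ Icc t₀ t₁) (hLt : L * (t - t₀) ≤ 1) :
    ‖timeDependentMPF a k H t t₀ - U t t₀‖ ≤
      2 * Real.exp (Real.exp 1) * ((∑ j, |a j|) * (L * (t - t₀)) ^ N) := by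
  have ht₀ : t₀ ∈ Icc t₀ t₁ := left_mem_Icc.2 (ht.1.trans ht.2)
  have hG : DerivScaleLE (fun t => -Complex.I • H t) (Icc t₀ t₁) L := hL.neg_I_smul
  have hG_smooth : ContDiffOn ℝ (⊤ : ℕ∞) (fun t => -Complex.I • H t) (Icc t₀ t₁) :=
    hH.const_smul _
  obtain ⟨initial, deriv⟩ := hU t₀ ht₀
  rw [hG.eq_evalAt_evolutionSeries (u := fun τ => U τ t₀) hG_smooth
    (fun t ht => by simpa only [smul_mul_assoc] using deriv t ht) initial ht, timeDependentMPF]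
  simp only [midpointSteps_eq_evalAt hG hG_smooth ht, Complex.coe_smul]
  have length_le : |t - t₀| ≤ L⁻¹ := by
    rwa [abs_of_nonneg (sub_nonneg.2 ht.1), ← one_div, le_div_iff₀' hL₀]
  have bound := h.norm_sum_evalAt_midpointSeries_sub_le hN hk
    (hG.normLE_taylorSeries ht₀ (inv_nonneg.2 hL₀.le)) (inv_pos.2 hL₀) length_le
  rwa [mul_inv_cancel₀ hL₀.ne', inv_mul_cancel_left₀ hL₀.ne', div_inv_eq_mul, mul_comm |t - t₀|,
    abs_of_nonneg (sub_nonneg.2 ht.1)] at bound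

theorem OrderConditions.norm_timeDependentMPF_sub_le [NeZero d] (h : OrderConditions a k N)
    (hN : 0 < N) (hk : ∀ j, 0 < k j) (hL : DerivScaleLE H (Icc t₀ t₁) L) (hL₀ : 0 < L)
    (hherm : ∀ t ∈ Icc t₀ t₁, (H t).IsHermitian) (hH : ContDiffOn ℝ (⊤ : ℕ∞) H (Icc t₀ t₁))
    (hU : IsTimeEvolution H (Icc t₀ t₁) U) (ht : t ∈ Icc t₀ t₁) :
    ‖timeDependentMPF a k H t t₀ - U t t₀‖ ≤
      2 * Real.exp (Real.exp 1) * ((∑ j, |a j|) * (L * (t - t₀)) ^ N) := by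
  rcases le_or_gt (L * (t - t₀)) 1 with short | long
  · exact h.norm_timeDependentMPF_sub_le_of_le_one hN hk hL hL₀ hH hU ht short
  · have one_le_sum := h.one_le_sum_abs hN
    have one_le_exp : 1 ≤ Real.exp (Real.exp 1) := Real.one_le_exp (Real.exp_pos 1).le
    calc ‖timeDependentMPF a k H t t₀ - U t t₀‖ ≤ ∑ j, |a j| + 1 :=
          norm_timeDependentMPF_sub_le_of_hermitian hU hherm ht
      _ ≤ 2 * 1 * ((∑ j, |a j|) * 1 ^ N) := by rw [one_pow]; linarith
      _ ≤ 2 * Real.exp (Real.exp 1) * ((∑ j, |a j|) * (L * (t - t₀)) ^ N) := by gcongr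

end Hamiltonian

end MPF

open MPF in
theorem mainTheorem3_general {M N d : ℕ} {a : Fin M → ℝ} {k : Fin M → ℕ} (h : OrderConditions a k N)
    (hN : 0 < N) (hk : ∀ j, 0 < k j) {H : ℝ → Op d} {t₀ t₁ t : ℝ}
    (hherm : ∀ t ∈ Icc t₀ t₁, (H t).IsHermitian) (hH : ContDiffOn ℝ (⊤ : ℕ∞) H (Icc t₀ t₁))
    (hb : BddAbove (derivScales H (Icc t₀ t₁))) {U : ℝ → ℝ → Op d}
    (hU : IsTimeEvolution H (Icc t₀ t₁) U) (ht : t ∈ Icc t₀ t₁) :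
    ‖timeDependentMPF a k H t t₀ - U t t₀‖ ≤
      2 * Real.exp (Real.exp 1) * ((∑ j, |a j|) * (Lam H (Icc t₀ t₁) * (t - t₀)) ^ N) := by
  set Λ := Lam H (Icc t₀ t₁)
  have scale_Λ : DerivScaleLE H (Icc t₀ t₁) Λ := derivScaleLE_Lam hb
  have Λ_nonneg : 0 ≤ Λ := (norm_nonneg _).trans (scale_Λ.norm_le ht)
  have length_nonneg : 0 ≤ t - t₀ := sub_nonneg.2 ht.1
  rcases eq_zero_or_neZero d with rfl | _
  · rw [Subsingleton.elim (timeDependentMPF a k H t t₀ - U t t₀) 0, norm_zero]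
    positivity
  -- Letting `L` tend to `Λ` covers the case `Λ = 0`, in which the weight `1 / Λ` is not available.
  have bound_of_gt (L : ℝ) (hL : Λ < L) : ‖timeDependentMPF a k H t t₀ - U t t₀‖ ≤
      2 * Real.exp (Real.exp 1) * ((∑ j, |a j|) * (L * (t - t₀)) ^ N) :=
    h.norm_timeDependentMPF_sub_le hN hk
      (fun p t ht => (scale_Λ p t ht).trans (by gcongr)) (Λ_nonneg.trans_lt hL) hherm hH hU ht
  have bound_continuous : Continuous fun L : ℝ =>
      2 * Real.exp (Real.exp 1) * ((∑ j, |a j|) * (L * (t - t₀)) ^ N) := by fun_prop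
  exact ge_of_tendsto ((bound_continuous.tendsto Λ).mono_left (nhdsWithin_le_nhds (s := Ioi Λ)))
    (eventually_nhdsWithin_of_forall bound_of_gt)

theorem mainTheorem3 :
    ∃ C : ℝ, 0 < C ∧
      ∀ (M : ℕ) (a : Fin M → ℝ) (k : Fin M → ℕ), MPF.IsMPFData a k →
      ∀ (d : ℕ) (H : ℝ → MPF.Op d) (n_p q : ℕ),
        (∀ t ∈ Icc (0 : ℝ) (2 ^ q), (H t).IsHermitian) →
        ContDiffOn ℝ (⊤ : ℕ∞) H (Icc 0 (2 ^ q)) →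
        MPF.ClockPeriodic H n_p q →
        BddAbove (MPF.derivScales H (Icc 0 (2 ^ q))) →
      ∀ U : ℝ → ℝ → MPF.Op d, MPF.IsTimeEvolution H (Icc 0 (2 ^ q)) U →
      ∀ s : ℝ, 0 ≤ s → s / 2 ^ n_p ≤ 2 ^ q →
        ‖MPF.timeDependentMPF a k H (s / 2 ^ n_p) 0 - U (s / 2 ^ n_p) 0‖ ≤
          C * ((∑ j, |a j|) * (MPF.Lam H (Icc 0 (2 ^ q)) * (s / 2 ^ n_p)) ^ (2 * M + 1)) := by
  refine ⟨2 * Real.exp (Real.exp 1), by positivity,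
    fun M a k hdata d H n_p q hherm hH _ hb U hU s hs hsq => ?_⟩
  have time_mem : s / 2 ^ n_p ∈ Icc (0 : ℝ) (2 ^ q) := ⟨by positivity, hsq⟩
  simpa only [sub_zero] using
    mainTheorem3_general hdata.orderConditions (Nat.succ_pos _) hdata.1 hherm hH hb hU time_mem
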